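/- **Setting.** Let $X$ be a connected (simple) graph with vertex set $VX$. For $C\subseteq VX$ let $NC$ be the set of vertices outside $C$ adjacent to a vertex of $C$, and let $C^*=VX\setminus(C\cup NC)$. The *corners* of $C,D$ are $C\cap D$, $C^*\cap D$, $C\cap D^*$, $C^*\cap D^*$; the pairs $C\cap D,\ C^*\cap D^*$ and $C\cap D^*,\ C^*\cap D$ are *opposite*. A *cut system* is a set $\mathcal C$ of non-empty connected sets of vertices $C$ (the *cuts*) with $NC$ finite and $C^{**}=C$ such that for all $C,D\in\mathcal C$ (including $C=D$): (A1) if two opposite corners of $C,D$ each contain an element of $\mathcal C$, then every component of either of them which contains an element of $\mathcal C$ belongs to $\mathcal C$; (A2) there are two opposite corners of $C,D$ each of which contains an element of $\mathcal C$. The sets $NC$, $C\in\mathcal C$, are the *separators*. A cut $C$ is *thin* if $|NC|$ is minimal among all cuts. Cuts $C,D$ are *nested* if for some $E\in\{C,C^*\}$, $F\in\{D,D^*\}$ the corner $E\cap F$ contains no cut and $E\cap ND=F\cap NC=\emptyset$. For a cut $C$ let $\mu(C)$ be the number of thin cuts with which $C$ is not nested; a thin cut is *optimally nested* if it minimizes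 $\mu$ among the thin cuts. Given a set $\mathcal N$ of cuts, an *($\mathcal N$-)slice* is a component of some $VX\setminus NC$, $C\in\mathcal N$, that is not in $\mathcal N$. Let $\hat X$ be the graph whose vertices are the vertices of $X$ in no slice, two distinct ones being adjacent if they are adjacent in $X$ or both lie in $NQ$ for some slice $Q$. Put $\hat C=C\cap V\hat X$. For $C,D\in\mathcal N$ write $C\sim D$ if $\hat C=\hat D$, or if (with $*$ taken in $\hat X$) $\hat C^*\subsetneq\hat D$ and every $E\in\mathcal N$ with $\hat C^*\subsetneq\hat E\subseteq\hat D$ has $\hat E=\hat D$. Let $T(\mathcal N)$ be the graph whose vertex set is the disjoint union of the set of separators $\{NC: C\in\mathcal N\}$ and the set of classes $[C]=\{D\in\mathcal N: C\sim D\}$, in which each $C\in\mathcal N$ gives an edge from $o(C)=NC$ to $t(C)=[C]$. **Theorem 8.1.** Let $X$ be a connected graph, let $G$ be a group acting on $X$ by automorphisms, and let $\mathcal C$ be a non-empty $G$-invariant cut system in $X$. Let $\mathcal N$ be the set of optimally nested thin cuts in $\mathcal C$. Then $\mathcal N$ is a cut system whose elements are pairwise nested, $\sim$ is an equivalence relation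 on $\mathcal N$, and $T(\mathcal N)$ is a $G$-tree with edge set $\mathcal N$. That is: $T(\mathcal N)$ is a tree; $C\mapsto\{o(C),t(C)\}$ is a bijection from $\mathcal N$ onto its set of edges; and $\mathcal N$ is $G$-invariant and $G$ acts on $T(\mathcal N)$ by graph automorphisms with $g\cdot o(C)=o(gC)$ and $g\cdot t(C)=t(gC)$ for all $g\in G$, $C\in\mathcal N$. -/

import Mathlib

open scoped Pointwise

universe u v

namespace CutSystems

variable {V : Type u}

/-- The boundary `NC`: the vertices outside `C` that are adjacent to a vertex of `C`. -/
def boundary (X : SimpleGraph V) (C : Set V) : Set V :=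
  {v | v ∉ C ∧ ∃ u ∈ C, X.Adj u v}

/-- The `*`-complement `C* = VX \ (C ∪ NC)`. -/
def star (X : SimpleGraph V) (C : Set V) : Set V :=
  (C ∪ boundary X C)ᶜ

/-- `K` is a (connected) component of the set of vertices `A`: a maximal connected subset.
Mathlib's `Connected` includes non-emptiness. -/
def IsComponent (X : SimpleGraph V) (A K : Set V) : Prop :=
  Maximal (fun L : Set V => L ⊆ A ∧ (X.induce L).Connected) K

/-- `A` contains an element of the family `𝒞`. -/
def ContainsCut (𝒞 : Set (Set V)) (A : Set V) : Prop :=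
  ∃ E ∈ 𝒞, E ⊆ A

/-- `(A, B)` is an (ordered) pair of opposite corners of `C` and `D`. -/
def OppositeCorners (X : SimpleGraph V) (C D A B : Set V) : Prop :=
  (A = C ∩ D ∧ B = star X C ∩ star X D) ∨
  (A = star X C ∩ star X D ∧ B = C ∩ D) ∨
  (A = C ∩ star X D ∧ B = star X C ∩ D) ∨
  (A = star X C ∩ D ∧ B = C ∩ star X D)

/-- Cut systems of a (connected) graph `X`. In `A1` it is enough to speak of the components of
the first corner `A`, as `OppositeCorners` is symmetric in `A` and `B`. -/
structure IsCutSystem (X : SimpleGraph V) (𝒞 : Set (Set V)) : Prop where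
  nonempty : ∀ C ∈ 𝒞, C.Nonempty
  connected : ∀ C ∈ 𝒞, (X.induce C).Connected
  finite_boundary : ∀ C ∈ 𝒞, (boundary X C).Finite
  star_star : ∀ C ∈ 𝒞, star X (star X C) = C
  A1 : ∀ C ∈ 𝒞, ∀ D ∈ 𝒞, ∀ A B : Set V, OppositeCorners X C D A B →
    ContainsCut 𝒞 A → ContainsCut 𝒞 B →
      ∀ K : Set V, IsComponent X A K → ContainsCut 𝒞 K → K ∈ 𝒞
  A2 : ∀ C ∈ 𝒞, ∀ D ∈ 𝒞, ∃ A B : Set V, OppositeCorners X C D A B ∧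
    ContainsCut 𝒞 A ∧ ContainsCut 𝒞 B

/-- The set of thin cuts: the cuts whose boundary has the smallest cardinality. -/
def thinCuts (X : SimpleGraph V) (𝒞 : Set (Set V)) : Set (Set V) :=
  {C | C ∈ 𝒞 ∧ ∀ D ∈ 𝒞, (boundary X C).encard ≤ (boundary X D).encard}

/-- `C` and `D` are nested: some corner `E ∩ F`, with `E ∈ {C, C*}` and `F ∈ {D, D*}`, is
isolated, that is, it contains no cut and both its adjacent links `E ∩ ND` and `F ∩ NC`
are empty. -/
def Nested (X : SimpleGraph V) (𝒞 : Set (Set V)) (C D : Set V) : Prop :=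
  ∃ E F : Set V, (E = C ∨ E = star X C) ∧ (F = D ∨ F = star X D) ∧
    ¬ ContainsCut 𝒞 (E ∩ F) ∧ E ∩ boundary X D = ∅ ∧ F ∩ boundary X C = ∅

/-- The number `μ(C)` of thin cuts that are not nested with `C`. -/
noncomputable def mu (X : SimpleGraph V) (𝒞 : Set (Set V)) (C : Set V) : ℕ∞ :=
  {D | D ∈ thinCuts X 𝒞 ∧ ¬ Nested X 𝒞 C D}.encard

/-- The set of optimally nested thin cuts: the thin cuts at which `μ` is minimal. -/
def optimallyNested (X : SimpleGraph V) (𝒞 : Set (Set V)) : Set (Set V) :=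
  {C | C ∈ thinCuts X 𝒞 ∧ ∀ D ∈ thinCuts X 𝒞, mu X 𝒞 C ≤ mu X 𝒞 D}

/-- A slice: a component of the complement of a separator that is not a cut. -/
def IsSlice (X : SimpleGraph V) (𝒞 : Set (Set V)) (Q : Set V) : Prop :=
  Q ∉ 𝒞 ∧ ∃ C ∈ 𝒞, IsComponent X (boundary X C)ᶜ Q

/-- The vertices of `X̂`: the vertices of `X` that lie in no slice. -/
def hatVertices (X : SimpleGraph V) (𝒞 : Set (Set V)) : Set V :=
  {v | ∀ Q, IsSlice X 𝒞 Q → v ∉ Q}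

/-- The graph `X̂`: the slices are deleted, and any two distinct vertices in the boundary of a
slice become adjacent. -/
def hatGraph (X : SimpleGraph V) (𝒞 : Set (Set V)) : SimpleGraph (hatVertices X 𝒞) where
  Adj u v := u ≠ v ∧ (X.Adj u v ∨
    ∃ Q, IsSlice X 𝒞 Q ∧ (u : V) ∈ boundary X Q ∧ (v : V) ∈ boundary X Q)
  symm := ⟨fun _ _ h => ⟨h.1.symm, h.2.imp (fun e => e.symm)
    fun ⟨Q, hQ, hu, hv⟩ => ⟨Q, hQ, hv, hu⟩⟩⟩
  loopless := ⟨fun _ h => h.1 rfl⟩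

/-- `Ĉ = C ∩ VX̂`, as a set of vertices of `X̂`. -/
def hatCut (X : SimpleGraph V) (𝒞 : Set (Set V)) (C : Set V) : Set (hatVertices X 𝒞) :=
  {v | (v : V) ∈ C}

/-- The family `𝒞̂` of all `Ĉ` with `C ∈ 𝒞`. -/
def hatSystem (X : SimpleGraph V) (𝒞 : Set (Set V)) : Set (Set (hatVertices X 𝒞)) :=
  hatCut X 𝒞 '' 𝒞

/-- The relation whose classes are the black vertices, for a system without slices:
`C = D`, or `C* ⊊ D` and there is no other cut `E` with `C* ⊊ E ⊆ D` than `E = D`. -/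
def Equiv₀ (X : SimpleGraph V) (𝒞 : Set (Set V)) (C D : Set V) : Prop :=
  C = D ∨ (star X C ⊂ D ∧ ∀ E ∈ 𝒞, star X C ⊂ E → E ⊆ D → E = D)

/-- The relation `C ∼ D` in general: the relation above holds for `Ĉ` and `D̂` in the graph
`X̂`, which has no slices. -/
def CutEquiv (X : SimpleGraph V) (𝒞 : Set (Set V)) (C D : Set V) : Prop :=
  Equiv₀ (hatGraph X 𝒞) (hatSystem X 𝒞) (hatCut X 𝒞 C) (hatCut X 𝒞 D)

/-- The class `[C]` of the cut `C` under `∼`. -/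
def cutClass (X : SimpleGraph V) (𝒞 : Set (Set V)) (C : Set V) : Set (Set V) :=
  {D | D ∈ 𝒞 ∧ CutEquiv X 𝒞 C D}

/-- The vertices of the structure tree: the disjoint union of the set of separators and the set
of classes of cuts. -/
abbrev TreeVertex (X : SimpleGraph V) (𝒞 : Set (Set V)) : Type u :=
  (boundary X '' 𝒞 : Set (Set V)) ⊕ (cutClass X 𝒞 '' 𝒞 : Set (Set (Set V)))

/-- The origin `o(C) = NC` of the edge `C`. -/
def origin (X : SimpleGraph V) (𝒞 : Set (Set V)) (C : 𝒞) : TreeVertex X 𝒞 :=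
  Sum.inl ⟨boundary X C, C, C.2, rfl⟩

/-- The terminus `t(C) = [C]` of the edge `C`. -/
def terminus (X : SimpleGraph V) (𝒞 : Set (Set V)) (C : 𝒞) : TreeVertex X 𝒞 :=
  Sum.inr ⟨cutClass X 𝒞 C, C, C.2, rfl⟩

/-- The structure graph of `𝒞`: every cut `C` joins its origin to its terminus. -/
def structureTree (X : SimpleGraph V) (𝒞 : Set (Set V)) : SimpleGraph (TreeVertex X 𝒞) where
  Adj a b := ∃ C : 𝒞, (a = origin X 𝒞 C ∧ b = terminus X 𝒞 C) ∨
    (b = origin X 𝒞 C ∧ a = terminus X 𝒞 C)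
  symm := ⟨fun _ _ ⟨C, h⟩ => ⟨C, h.symm⟩⟩
  loopless := ⟨by
    rintro a ⟨C, ⟨h, h'⟩ | ⟨h, h'⟩⟩ <;> rw [h] at h' <;> exact Sum.inl_ne_inr h'⟩

end CutSystems

/-! ### Boundaries, stars and connected components. -/

namespace CutSystems

variable {V : Type u} {X : SimpleGraph V}

/-! The first half is uncrossing. If thin cuts `C`, `D` are not nested, A2 gives two opposite
corners containing cuts. The boundaries of these corners have total size `|NC| + |ND|`, so
minimality makes suitable components `K`, `K'` of them thin, with the full corner boundaries
(`corner_thin`). For thin cuts, nestedness depends only on the separators: `ND` must miss some cut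
with separator `NC` (`nested_iff`). It follows that a thin cut nested with both `C` and `D` is
nested with both `K` and `K'` (`nested_corner`), and one nested with `C` or with `D` is nested with
`K` or `K'`. As `C` crosses `D` but neither `K` nor `K'`, this gives `μ(K) + μ(K') < μ(C) + μ(D)`.
The strictness needs `μ` finite, which holds because only finitely many separators of given size
tightly separate two vertices. So optimally nested cuts cannot cross.

The second half forgets everything but `IsNestedFamily`: at each separator the cuts are directions,
and every other separator lies, up to the separator itself, in exactly one of them. Slices meet no
separator, so passing to `X̂` loses nothing, and `C ∼ D` for `C ≠ D` means that `C` and `D` face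
each other with no separator in between (`cutEquiv_iff`). Separators thus form a `DirectionSystem`.
Its bipartite graph is connected by induction on the finite number of points between two given ones.
It has no cycles because deleting the edge `C` cuts off exactly what is seen in direction `C`. Every
notion involved is `G`-equivariant. -/

theorem mem_boundary {C : Set V} {v : V} :
    v ∈ boundary X C ↔ v ∉ C ∧ ∃ u ∈ C, X.Adj u v := Iff.rfl

theorem disjoint_boundary (X : SimpleGraph V) (C : Set V) : Disjoint C (boundary X C) :=
  Set.disjoint_left.2 fun _ h h' => h'.1 h

theorem mem_star {C : Set V} {v : V} : v ∈ star X C ↔ v ∉ C ∧ v ∉ boundary X C := by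
  simp [star]

theorem mem_or_mem_boundary_of_adj {C : Set V} {u v : V} (hu : u ∈ C) (h : X.Adj u v) :
    v ∈ C ∨ v ∈ boundary X C := by
  by_cases hv : v ∈ C
  · exact Or.inl hv
  · exact Or.inr ⟨hv, u, hu, h⟩

theorem mem_cases (X : SimpleGraph V) (C : Set V) (v : V) :
    v ∈ C ∨ v ∈ boundary X C ∨ v ∈ star X C := by
  rw [mem_star]; tauto

theorem boundary_star_subset (X : SimpleGraph V) (C : Set V) :
    boundary X (star X C) ⊆ boundary X C := by
  rintro v ⟨hv, u, hu, huv⟩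
  rw [mem_star] at hv hu
  by_contra hvN
  have hvC : v ∈ C := by tauto
  rcases mem_or_mem_boundary_of_adj hvC huv.symm with h | h <;> tauto

theorem boundary_star {C : Set V} (h : star X (star X C) = C) :
    boundary X (star X C) = boundary X C := by
  refine (boundary_star_subset X C).antisymm fun v hv => ?_
  by_contra hvN
  have : v ∈ star X (star X C) := by
    rw [mem_star]
    exact ⟨fun h => (mem_star.1 h).2 hv, hvN⟩
  rw [h] at this
  exact hv.1 this

theorem disjoint_star (X : SimpleGraph V) (C : Set V) : Disjoint C (star X C) :=
  Set.disjoint_left.2 fun _ h h' => (mem_star.1 h').1 h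

theorem disjoint_boundary_star (X : SimpleGraph V) (C : Set V) :
    Disjoint (boundary X C) (star X C) :=
  Set.disjoint_left.2 fun _ h h' => (mem_star.1 h').2 h

theorem subset_star_of_disjoint {C D : Set V} (h : Disjoint D C)
    (h' : Disjoint D (boundary X C)) : D ⊆ star X C := fun _ hv =>
  mem_star.2 ⟨Set.disjoint_left.1 h hv, Set.disjoint_left.1 h' hv⟩

/-- A connected set that meets `A` but not its boundary lies in `A`. -/
theorem connected_subset {L A : Set V} (hL : (X.induce L).Connected)
    (hd : Disjoint L (boundary X A)) (hne : (L ∩ A).Nonempty) : L ⊆ A := by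
  obtain ⟨x, hxL, hxA⟩ := hne
  intro y hy
  obtain ⟨p⟩ := hL.preconnected ⟨x, hxL⟩ ⟨y, hy⟩
  have key : ∀ a b : L, (X.induce L).Walk a b → (a : V) ∈ A → (b : V) ∈ A := by
    intro a b p
    induction p with
    | nil => exact id
    | @cons u v w h p ih =>
      intro hu
      refine ih ((mem_or_mem_boundary_of_adj hu h).resolve_right ?_)
      exact Set.disjoint_left.1 hd v.2
  exact key _ _ p hxA

theorem connected_singleton (X : SimpleGraph V) (v : V) : (X.induce ({v} : Set V)).Connected := by
  have : Unique ({v} : Set V) := Set.uniqueSingleton v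
  exact { preconnected := fun a b => by rw [Subsingleton.elim a b], nonempty := ⟨⟨v, rfl⟩⟩ }

/-- Adding a boundary vertex to a connected set leaves it connected. -/
theorem connected_insert {L : Set V} (hL : (X.induce L).Connected) {v : V}
    (hv : v ∈ boundary X L) : (X.induce (insert v L)).Connected := by
  obtain ⟨_, u, hu, huv⟩ := hv
  rw [← Set.singleton_union]
  exact SimpleGraph.connected_induce_union (connected_singleton X v).preconnected
    hL.preconnected rfl hu huv.symm

/-- Maximality in local form: a boundary vertex of `K` inside `A` could be added to `K`. -/
theorem isComponent_iff {A K : Set V} : IsComponent X A K ↔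
    K ⊆ A ∧ (X.induce K).Connected ∧ Disjoint A (boundary X K) := by
  constructor
  · intro h
    refine ⟨h.prop.1, h.prop.2, Set.disjoint_left.2 fun v hvA hv => hv.1 ?_⟩
    exact h.le_of_ge ⟨Set.insert_subset hvA h.prop.1, connected_insert h.prop.2 hv⟩
      (Set.subset_insert _ _) (Set.mem_insert _ _)
  · rintro ⟨h1, h2, h3⟩
    refine ⟨⟨h1, h2⟩, fun L hL hKL => connected_subset hL.2 (h3.mono_left hL.1) ?_⟩
    obtain ⟨v, hv⟩ := h2.nonempty
    exact ⟨v, hKL hv, hv⟩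

theorem nonempty_of_connected {L : Set V} (hL : (X.induce L).Connected) : L.Nonempty := by
  obtain ⟨v, hv⟩ := hL.nonempty
  exact ⟨v, hv⟩

/-- Every connected subset of `A` is contained in a component of `A`. -/
theorem exists_isComponent {A L : Set V} (hL : (X.induce L).Connected) (hLA : L ⊆ A) :
    ∃ K, IsComponent X A K ∧ L ⊆ K := by
  obtain ⟨x, hx⟩ := nonempty_of_connected hL
  set S : Set (Set V) := {M | M ⊆ A ∧ (X.induce M).Connected ∧ x ∈ M} with hS
  have hLS : L ∈ S := ⟨hLA, hL, hx⟩
  refine ⟨⋃₀ S, ⟨⟨Set.sUnion_subset fun M hM => hM.1, ?_⟩, ?_⟩, Set.subset_sUnion_of_mem hLS⟩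
  · exact SimpleGraph.induce_sUnion_connected_of_pairwise_not_disjoint ⟨L, hLS⟩
      (fun hs ht => ⟨x, hs.2.2, ht.2.2⟩) (fun hs => hs.2.1)
  · intro M hM hSM
    exact Set.subset_sUnion_of_mem ⟨hM.1, hM.2, hSM (Set.mem_sUnion_of_mem hx hLS)⟩

theorem exists_isComponent_mem (X : SimpleGraph V) {A : Set V} {v : V} (hv : v ∈ A) :
    ∃ K, IsComponent X A K ∧ v ∈ K := by
  obtain ⟨K, hK, h⟩ := exists_isComponent (connected_singleton X v) (Set.singleton_subset_iff.2 hv)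
  exact ⟨K, hK, h rfl⟩

/-- A connected set that avoids the boundary of `P`, while its own boundary meets `P`, lies in
`P`. -/
theorem connected_subset_of_boundary {M P : Set V} (hM : (X.induce M).Connected)
    (hd : Disjoint M (boundary X P)) (hne : (boundary X M ∩ P).Nonempty) : M ⊆ P := by
  obtain ⟨p, ⟨_, u, hu, hup⟩, hpP⟩ := hne
  exact connected_subset hM hd ⟨u, hu, (mem_or_mem_boundary_of_adj hpP hup.symm).resolve_right
    (Set.disjoint_left.1 hd hu)⟩

theorem boundary_subset_of_subset {M P : Set V} (h : M ⊆ P) :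
    boundary X M ⊆ P ∪ boundary X P := by
  rintro v ⟨_, u, hu, huv⟩
  exact mem_or_mem_boundary_of_adj (h hu) huv

theorem boundary_nonempty (hX : X.Connected) {C : Set V} (hC : C.Nonempty) (hC' : C ≠ Set.univ) :
    (boundary X C).Nonempty := by
  by_contra h
  rw [Set.not_nonempty_iff_eq_empty] at h
  apply hC'
  have hu : (X.induce (Set.univ : Set V)).Connected :=
    (SimpleGraph.induceUnivIso X).connected_iff.2 hX
  exact Set.eq_univ_of_univ_subset (connected_subset hu (by simp [h]) (by simpa using hC))

/-! ### Finitely many tight separators -/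

/-- The sets of cardinality `k` that are the common boundary of two disjoint connected sets,
one containing `x` and the other `y`. -/
def tightSeparators (X : SimpleGraph V) (x y : V) (k : ℕ) : Set (Set V) :=
  {T | T.Finite ∧ T.ncard = k ∧ ∃ P Q : Set V, (X.induce P).Connected ∧ (X.induce Q).Connected ∧
    x ∈ P ∧ y ∈ Q ∧ Disjoint P Q ∧ boundary X P = T ∧ boundary X Q = T}

/-- The graph with all edges at `v` deleted. -/
def isolate (X : SimpleGraph V) (v : V) : SimpleGraph V where
  Adj a b := X.Adj a b ∧ a ≠ v ∧ b ≠ v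
  symm := ⟨fun _ _ h => ⟨h.1.symm, h.2.2, h.2.1⟩⟩
  loopless := ⟨fun _ h => X.loopless.irrefl _ h.1⟩

theorem boundary_isolate {v : V} {P : Set V} (hv : v ∉ P) :
    boundary (isolate X v) P = boundary X P \ {v} := by
  ext w
  constructor
  · rintro ⟨h, u, hu, huw⟩
    exact ⟨⟨h, u, hu, huw.1⟩, huw.2.2⟩
  · rintro ⟨⟨h, u, hu, huw⟩, hwv⟩
    exact ⟨h, u, hu, huw, fun e => hv (e ▸ hu), hwv⟩

theorem induce_isolate {v : V} {P : Set V} (hv : v ∉ P) :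
    (isolate X v).induce P = X.induce P := by
  ext a b
  simp only [SimpleGraph.comap_adj, Function.Embedding.subtype_apply, isolate]
  exact ⟨fun h => h.1, fun h => ⟨h, fun e => hv (e ▸ a.2), fun e => hv (e ▸ b.2)⟩⟩

theorem diff_singleton_mem_tightSeparators {x y v : V} {k : ℕ} {T : Set V}
    (hT : T ∈ tightSeparators X x y (k + 1)) (hv : v ∈ T) :
    T \ {v} ∈ tightSeparators (isolate X v) x y k := by
  obtain ⟨hf, hk, P, Q, hP, hQ, hx, hy, hd, hPT, hQT⟩ := hT
  have hvP : v ∉ P := by rw [← hPT] at hv; exact hv.1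
  have hvQ : v ∉ Q := by rw [← hQT] at hv; exact hv.1
  refine ⟨hf.sdiff, ?_, P, Q, ?_, ?_, hx, hy, hd, ?_, ?_⟩
  · rw [Set.ncard_sdiff_singleton_of_mem hv, hk]; rfl
  · rwa [induce_isolate hvP]
  · rwa [induce_isolate hvQ]
  · rw [boundary_isolate hvP, hPT]
  · rw [boundary_isolate hvQ, hQT]

/-- There are only finitely many tight separators of a given finite size between two vertices. -/
theorem finite_tightSeparators (k : ℕ) : ∀ (X : SimpleGraph V) (x y : V),
    (tightSeparators X x y k).Finite := by
  induction k with
  | zero =>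
    intro X x y
    refine (Set.finite_singleton (∅ : Set V)).subset ?_
    rintro T ⟨hf, hk, -⟩
    exact (Set.ncard_eq_zero hf).1 hk
  | succ k ih =>
    intro X x y
    by_cases hr : X.Reachable x y
    · obtain ⟨p⟩ := hr
      have hfin : (⋃ v ∈ {v | v ∈ p.support},
          (insert v '' tightSeparators (isolate X v) x y k : Set (Set V))).Finite :=
        (List.finite_toSet p.support).biUnion fun v _ => (ih _ _ _).image _
      refine hfin.subset fun T hT => ?_
      -- A walk from `x` to `y` has to leave `P` through `T`, so one of its finitely many vertices
      -- can be removed from `T`, lowering `k`.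
      have hv : ∃ v ∈ p.support, v ∈ T := by
        by_contra! hcon
        obtain ⟨-, -, P, Q, hP, hQ, hx, hy, hd, hPT, hQT⟩ := hT
        have := connected_subset (A := P) p.connected_induce_support
          (Set.disjoint_left.2 fun v hv => hPT ▸ hcon v hv) ⟨x, p.start_mem_support, hx⟩
        exact Set.disjoint_left.1 hd (this p.end_mem_support) hy
      obtain ⟨v, hvp, hvT⟩ := hv
      simp only [Set.mem_iUnion]
      exact ⟨v, hvp, T \ {v}, diff_singleton_mem_tightSeparators hT hvT, by simp [hvT]⟩
    · refine Set.finite_empty.subset ?_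
      rintro T ⟨hf, hk, P, Q, hP, hQ, hx, hy, hd, hPT, hQT⟩
      obtain ⟨t, ht⟩ : T.Nonempty := Set.nonempty_of_ncard_ne_zero (by omega)
      apply hr
      have key : ∀ {P : Set V} {x : V}, (X.induce P).Connected → x ∈ P → boundary X P = T →
          X.Reachable x t := by
        intro P x hP hx hPT
        obtain ⟨-, u, hu, hut⟩ := (hPT ▸ ht : t ∈ boundary X P)
        have := (hP.preconnected ⟨x, hx⟩ ⟨u, hu⟩).map (SimpleGraph.Embedding.induce P).toHom
        exact SimpleGraph.Reachable.trans this hut.reachable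
      exact (key hP hx hPT).trans (key hQ hy hQT).symm

end CutSystems

/-! ### Corners of thin cuts and nestedness. -/

namespace CutSystems

variable {V : Type u} {X : SimpleGraph V} {𝒞 : Set (Set V)}

/-- `E` is one of the two sides `C`, `C*` of `C`. -/
def IsSide (X : SimpleGraph V) (C E : Set V) : Prop := E = C ∨ E = star X C

/-- The union of the links and the centre that bound the corner `E ∩ F`. -/
def cornerBoundary (X : SimpleGraph V) (E F : Set V) : Set V :=
  E ∩ boundary X F ∪ boundary X E ∩ boundary X F ∪ F ∩ boundary X E

theorem IsSide.refl (X : SimpleGraph V) (C : Set V) : IsSide X C C := Or.inl rfl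

theorem IsSide.star_right {C E : Set V} (hC : star X (star X C) = C) (h : IsSide X C E) :
    IsSide X C (star X E) := by
  rcases h with rfl | rfl
  · exact Or.inr rfl
  · exact Or.inl hC

theorem IsSide.star_star {C E : Set V} (hC : star X (star X C) = C) (h : IsSide X C E) :
    star X (star X E) = E := by
  rcases h with rfl | rfl
  · exact hC
  · rw [hC]

theorem IsSide.boundary_eq {C E : Set V} (hC : star X (star X C) = C) (h : IsSide X C E) :
    boundary X E = boundary X C := by
  rcases h with rfl | rfl
  · rfl
  · exact boundary_star hC

theorem boundary_subset_cornerBoundary {E F K : Set V} (hK : IsComponent X (E ∩ F) K) :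
    boundary X K ⊆ cornerBoundary X E F := by
  obtain ⟨h1, -, h3⟩ := isComponent_iff.1 hK
  intro v hv
  have hvE := boundary_subset_of_subset (h1.trans Set.inter_subset_left) hv
  have hvF := boundary_subset_of_subset (h1.trans Set.inter_subset_right) hv
  have hv' : ¬ (v ∈ E ∧ v ∈ F) := fun h => Set.disjoint_left.1 h3 h hv
  simp only [cornerBoundary, Set.mem_union, Set.mem_inter_iff] at *
  tauto

/-- Opposite corners have boundaries with the same sum and intersection as the separators. -/
theorem cornerBoundary_union_star {E F : Set V} (hE : star X (star X E) = E)
    (hF : star X (star X F) = F) :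
    cornerBoundary X E F ∪ cornerBoundary X (star X E) (star X F) =
      boundary X E ∪ boundary X F := by
  ext v
  have := mem_cases X E v
  have := mem_cases X F v
  simp only [cornerBoundary, boundary_star hE, boundary_star hF, Set.mem_union, Set.mem_inter_iff]
  tauto

theorem cornerBoundary_inter_star {E F : Set V} (hE : star X (star X E) = E)
    (hF : star X (star X F) = F) :
    cornerBoundary X E F ∩ cornerBoundary X (star X E) (star X F) =
      boundary X E ∩ boundary X F := by
  ext v
  have h1 := (mem_star (X := X) (C := E) (v := v))
  have h2 := (mem_star (X := X) (C := F) (v := v))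
  have h3 : v ∈ E → v ∉ boundary X E := fun h => Set.disjoint_left.1 (disjoint_boundary X E) h
  have h4 : v ∈ F → v ∉ boundary X F := fun h => Set.disjoint_left.1 (disjoint_boundary X F) h
  simp only [cornerBoundary, boundary_star hE, boundary_star hF, Set.mem_union, Set.mem_inter_iff]
  tauto

theorem ContainsCut.mono {A B : Set V} (h : ContainsCut 𝒞 A) (hAB : A ⊆ B) : ContainsCut 𝒞 B :=
  let ⟨E, hE, hEA⟩ := h
  ⟨E, hE, hEA.trans hAB⟩

theorem opposite_of_isSide {C D E F : Set V} (hC : star X (star X C) = C)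
    (hD : star X (star X D) = D) (hE : IsSide X C E) (hF : IsSide X D F) :
    OppositeCorners X C D (E ∩ F) (star X E ∩ star X F) := by
  rcases hE with rfl | rfl <;> rcases hF with rfl | rfl
  · exact Or.inl ⟨rfl, rfl⟩
  · rw [hD]; exact Or.inr (Or.inr (Or.inl ⟨rfl, rfl⟩))
  · rw [hC]; exact Or.inr (Or.inr (Or.inr ⟨rfl, rfl⟩))
  · rw [hC, hD]; exact Or.inr (Or.inl ⟨rfl, rfl⟩)

theorem exists_isSide_of_opposite {C D A B : Set V} (hC : star X (star X C) = C)
    (hD : star X (star X D) = D) (h : OppositeCorners X C D A B) :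
    ∃ E F, IsSide X C E ∧ IsSide X D F ∧ A = E ∩ F ∧ B = star X E ∩ star X F := by
  rcases h with h | h | h | h
  · exact ⟨C, D, Or.inl rfl, Or.inl rfl, h⟩
  · exact ⟨star X C, star X D, Or.inr rfl, Or.inr rfl, by rwa [hC, hD]⟩
  · exact ⟨C, star X D, Or.inl rfl, Or.inr rfl, by rwa [hD]⟩
  · exact ⟨star X C, D, Or.inr rfl, Or.inl rfl, by rwa [hC]⟩

namespace IsCutSystem

/-- A2 without the case list: a pair of opposite corners uses both sides of `C`, so the side `E` of
the first corner can be prescribed. -/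
theorem exists_corners (hC : IsCutSystem X 𝒞) {C D E : Set V} (hCC : C ∈ 𝒞) (hDC : D ∈ 𝒞)
    (hE : IsSide X C E) :
    ∃ F, IsSide X D F ∧ ContainsCut 𝒞 (E ∩ F) ∧ ContainsCut 𝒞 (star X E ∩ star X F) := by
  have hsC := hC.star_star C hCC
  have hsD := hC.star_star D hDC
  obtain ⟨A, B, hAB, hA, hB⟩ := hC.A2 C hCC D hDC
  obtain ⟨E', F, hE', hF, rfl, rfl⟩ := exists_isSide_of_opposite hsC hsD hAB
  have : E = E' ∨ E = star X E' := by
    rcases hE with rfl | rfl <;> rcases hE' with rfl | rfl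
    · exact Or.inl rfl
    · exact Or.inr hsC.symm
    · exact Or.inr rfl
    · exact Or.inl rfl
  rcases this with rfl | rfl
  · exact ⟨F, hF, hA, hB⟩
  · refine ⟨star X F, hF.star_right hsD, hB, ?_⟩
    rwa [hE'.star_star hsC, hF.star_star hsD]

theorem mem_of_isComponent_corner (hC : IsCutSystem X 𝒞) {C D E F K : Set V} (hCC : C ∈ 𝒞)
    (hDC : D ∈ 𝒞)
    (hE : IsSide X C E) (hF : IsSide X D F) (hA : ContainsCut 𝒞 (star X E ∩ star X F))
    (hK : IsComponent X (E ∩ F) K) (hKc : ContainsCut 𝒞 K) : K ∈ 𝒞 :=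
  hC.A1 C hCC D hDC _ _
    (opposite_of_isSide (hC.star_star C hCC) (hC.star_star D hDC) hE hF)
    (hKc.mono (isComponent_iff.1 hK).1) hA K hK hKc

theorem containsCut_star (hC : IsCutSystem X 𝒞) {C : Set V} (hCC : C ∈ 𝒞) : ContainsCut 𝒞
    (star X C) := by
  obtain ⟨F, hF, h1, h2⟩ := hC.exists_corners hCC hCC (IsSide.refl X C)
  rcases hF with rfl | rfl
  · exact h2.mono Set.inter_subset_left
  · exact h1.mono Set.inter_subset_right

theorem subset_side {C L : Set V} (hL : (X.induce L).Connected)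
    (hd : Disjoint L (boundary X C)) : L ⊆ C ∨ L ⊆ star X C := by
  by_cases h : (L ∩ C).Nonempty
  · exact Or.inl (connected_subset hL hd h)
  · exact Or.inr (subset_star_of_disjoint
      (Set.disjoint_iff_inter_eq_empty.2 (Set.not_nonempty_iff_eq_empty.1 h)) hd)

theorem exists_component_containsCut (hC : IsCutSystem X 𝒞) {A : Set V} (hA : ContainsCut 𝒞 A) :
    ∃ K, IsComponent X A K ∧ ContainsCut 𝒞 K := by
  obtain ⟨E, hE, hEA⟩ := hA
  obtain ⟨K, hK, h⟩ := exists_isComponent (hC.connected E hE) hEA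
  exact ⟨K, hK, E, hE, h⟩

theorem isComponent_compl_boundary (hC : IsCutSystem X 𝒞) {C : Set V} (hCC : C ∈ 𝒞) :
    IsComponent X (boundary X C)ᶜ C :=
  isComponent_iff.2 ⟨Set.subset_compl_iff_disjoint_right.2 (disjoint_boundary X C),
    hC.connected C hCC, disjoint_compl_left⟩

theorem eq_or_subset_star (hC : IsCutSystem X 𝒞) {C K : Set V} (hCC : C ∈ 𝒞) (hK : IsComponent X
    (boundary X C)ᶜ K) :
    K = C ∨ K ⊆ star X C := by
  have h := isComponent_iff.1 hK
  refine (subset_side h.2.1 (Set.subset_compl_iff_disjoint_right.1 h.1)).imp_left fun hs => ?_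
  exact hs.antisymm (hK.le_of_ge (hC.isComponent_compl_boundary hCC).prop hs)

/-- A component of the complement of a separator that contains a cut is a cut. -/
theorem mem_of_isComponent_compl (hC : IsCutSystem X 𝒞) {C K : Set V} (hCC : C ∈ 𝒞)
    (hK : IsComponent X (boundary X C)ᶜ K) (hKc : ContainsCut 𝒞 K) : K ∈ 𝒞 := by
  rcases hC.eq_or_subset_star hCC hK with rfl | h
  · exact hCC
  -- A1 with `D = C`: the opposite corners are `C* ∩ C* = C*` and `C ∩ C = C`.
  · refine hC.mem_of_isComponent_corner hCC hCC (Or.inr rfl) (Or.inr rfl) ?_ ?_ hKc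
    · rw [hC.star_star C hCC, Set.inter_self]
      exact ⟨C, hCC, subset_rfl⟩
    · rw [Set.inter_self]
      have h' := isComponent_iff.1 hK
      exact isComponent_iff.2 ⟨h, h'.2.1, h'.2.2.mono_left
        (Set.subset_compl_iff_disjoint_left.2 (disjoint_boundary_star X C))⟩

theorem finite_thin (hC : IsCutSystem X 𝒞) {C : Set V} (h : C ∈ thinCuts X 𝒞) :
    (boundary X C).Finite :=
  hC.finite_boundary C h.1

theorem encard_eq_thin {C D : Set V} (h : C ∈ thinCuts X 𝒞) (h' : D ∈ thinCuts X 𝒞) :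
    (boundary X C).encard = (boundary X D).encard :=
  (h.2 D h'.1).antisymm (h'.2 C h.1)

theorem thin_of_encard_le {C D : Set V} (h : C ∈ thinCuts X 𝒞) (hD : D ∈ 𝒞)
    (hle : (boundary X D).encard ≤ (boundary X C).encard) : D ∈ thinCuts X 𝒞 :=
  ⟨hD, fun E hE => hle.trans (h.2 E hE)⟩

theorem boundary_eq_of_subset (hC : IsCutSystem X 𝒞) {C D : Set V} (h : C ∈ thinCuts X 𝒞)
    (hD : D ∈ 𝒞)
    (hs : boundary X D ⊆ boundary X C) : boundary X D = boundary X C :=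
  (hC.finite_thin h).eq_of_subset_of_encard_le' hs (h.2 D hD)

theorem boundary_eq_of_isComponent (hC : IsCutSystem X 𝒞) {C K : Set V} (h : C ∈ thinCuts X 𝒞)
    (hK : IsComponent X (boundary X C)ᶜ K) (hKc : K ∈ 𝒞) : boundary X K = boundary X C :=
  hC.boundary_eq_of_subset h hKc (by
    simpa using Set.subset_compl_iff_disjoint_left.2 (isComponent_iff.1 hK).2.2)

/-- Each side of a thin cut contains a cut with the same separator. -/
theorem exists_cut_side (hC : IsCutSystem X 𝒞) {C E : Set V} (h : C ∈ thinCuts X 𝒞)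
    (hE : IsSide X C E) :
    ∃ M ∈ 𝒞, boundary X M = boundary X C ∧ M ⊆ E := by
  rcases hE with rfl | rfl
  · exact ⟨E, h.1, rfl, subset_rfl⟩
  · obtain ⟨M₀, hM₀, hs⟩ := hC.containsCut_star h.1
    obtain ⟨K, hK, hKM⟩ := exists_isComponent (A := (boundary X C)ᶜ) (hC.connected M₀ hM₀)
      (hs.trans (Set.subset_compl_iff_disjoint_left.2 (disjoint_boundary_star X C)))
    have hKc := hC.mem_of_isComponent_compl h.1 hK ⟨M₀, hM₀, hKM⟩
    refine ⟨K, hKc, hC.boundary_eq_of_isComponent h hK hKc, ?_⟩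
    rcases hC.eq_or_subset_star h.1 hK with rfl | h'
    · obtain ⟨x, hx⟩ := hC.nonempty M₀ hM₀
      exact absurd (hs hx) (Set.disjoint_left.1 (disjoint_star X K) (hKM hx))
    · exact h'

/-- Two opposite corners of thin cuts that both contain cuts yield thin cuts with the full
boundaries of these corners. -/
theorem corner_thin (hC : IsCutSystem X 𝒞) {C D E F K : Set V} (h : C ∈ thinCuts X 𝒞)
    (h' : D ∈ thinCuts X 𝒞)
    (hE : IsSide X C E) (hF : IsSide X D F) (hA : ContainsCut 𝒞 (star X E ∩ star X F))
    (hK : IsComponent X (E ∩ F) K) (hKc : ContainsCut 𝒞 K) :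
    K ∈ thinCuts X 𝒞 ∧ boundary X K = cornerBoundary X E F := by
  have hsC := hC.star_star C h.1
  have hsD := hC.star_star D h'.1
  have hKm : K ∈ 𝒞 := hC.mem_of_isComponent_corner h.1 h'.1 hE hF hA hK hKc
  obtain ⟨K', hK', hKc'⟩ := hC.exists_component_containsCut hA
  have hKm' : K' ∈ 𝒞 := by
    refine hC.mem_of_isComponent_corner h.1 h'.1 (hE.star_right hsC) (hF.star_right hsD) ?_
      hK' hKc'
    rw [hE.star_star hsC, hF.star_star hsD]
    exact hKc.mono (isComponent_iff.1 hK).1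
  have hU := boundary_subset_cornerBoundary hK
  have hU' := boundary_subset_cornerBoundary hK'
  have hun := cornerBoundary_union_star (hE.star_star hsC) (hF.star_star hsD)
  have hin := cornerBoundary_inter_star (hE.star_star hsC) (hF.star_star hsD)
  rw [hE.boundary_eq hsC, hF.boundary_eq hsD] at hun hin
  have hfC := hC.finite_thin h
  have hfD := hC.finite_thin h'
  set U := cornerBoundary X E F
  set U' := cornerBoundary X (star X E) (star X F)
  have hfU : U.Finite := (hfC.union hfD).subset (hun ▸ Set.subset_union_left)
  have hfU' : U'.Finite := (hfC.union hfD).subset (hun ▸ Set.subset_union_right)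
  have hsum : U.ncard + U'.ncard = (boundary X C).ncard + (boundary X D).ncard := by
    rw [← Set.ncard_union_add_ncard_inter U U' hfU hfU', hun, hin,
      Set.ncard_union_add_ncard_inter _ _ hfC hfD]
  have le1 : ∀ {L W : Set V}, L ∈ 𝒞 → boundary X L ⊆ W → W.Finite →
      (boundary X C).ncard ≤ W.ncard := by
    intro L W hL hLW hW
    refine le_trans ?_ (Set.ncard_le_ncard hLW hW)
    have := h.2 L hL
    rw [← hfC.cast_ncard_eq, ← (hW.subset hLW).cast_ncard_eq] at this
    exact_mod_cast this
  have heq : (boundary X C).ncard = (boundary X D).ncard := by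
    rw [Set.ncard_def, Set.ncard_def, encard_eq_thin h h']
  -- Both corner boundaries have at least the minimal size and together exactly twice that size, so
  -- neither exceeds it.
  have hk := le1 hKm hU hfU
  have hk' := le1 hKm' hU' hfU'
  have hUC : U.encard = (boundary X C).encard := by
    rw [← hfU.cast_ncard_eq, ← hfC.cast_ncard_eq]
    congr 1
    omega
  have hb : boundary X K = U :=
    hfU.eq_of_subset_of_encard_le' hU (hUC ▸ h.2 K hKm)
  exact ⟨thin_of_encard_le h hKm (by rw [hb, hUC]), hb⟩

/-- Separators of thin cuts do not meet those components of the complement of a thin separator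
that are not cuts. -/
theorem disjoint_slice_boundary (hC : IsCutSystem X 𝒞) {C D Q : Set V} (h : C ∈ thinCuts X 𝒞)
    (h' : D ∈ thinCuts X 𝒞)
    (hQ : IsComponent X (boundary X C)ᶜ Q) (hQc : Q ∉ 𝒞) : Disjoint Q (boundary X D) := by
  have hsC := hC.star_star C h.1
  have hQs : Q ⊆ star X C := by
    rcases hC.eq_or_subset_star h.1 hQ with rfl | hs
    · exact absurd h.1 hQc
    · exact hs
  obtain ⟨F, hF, h1, h2⟩ := hC.exists_corners h.1 h'.1 (Or.inr rfl : IsSide X C (star X C))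
  obtain ⟨K, hK, hKc⟩ := hC.exists_component_containsCut h1
  have hb := (hC.corner_thin h h' (Or.inr rfl) hF h2 hK hKc).2
  have hKi := isComponent_iff.1 hK
  have hQi := isComponent_iff.1 hQ
  have hNQ : boundary X Q ⊆ boundary X C := by
    simpa using Set.subset_compl_iff_disjoint_left.2 hQi.2.2
  have hKC : Disjoint K (boundary X C) :=
    -- A vertex of `Q ∩ ND` would lie in the full corner boundary `NK`. Since `K` avoids `NC`, this
    -- places `K` inside `Q`, and a component containing a cut is a cut.
    (disjoint_boundary_star X C).symm.mono_left (hKi.1.trans Set.inter_subset_left)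
  refine Set.disjoint_left.2 fun q hq hqD => hQc ?_
  refine hC.mem_of_isComponent_compl h.1 hQ (hKc.mono ?_)
  refine connected_subset_of_boundary hKi.2.1 (hKC.mono_right hNQ) ⟨q, ?_, hq⟩
  rw [hb, cornerBoundary, hF.boundary_eq (hC.star_star D h'.1)]
  exact Or.inl (Or.inl ⟨hQs hq, hqD⟩)

/-- For thin cuts, `C` and `D` are nested exactly if the separator of `D` misses some cut that has
the same separator as `C`. -/
theorem nested_iff (hC : IsCutSystem X 𝒞) {C D : Set V} (h : C ∈ thinCuts X 𝒞)
    (h' : D ∈ thinCuts X 𝒞) :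
    Nested X 𝒞 C D ↔ ∃ M ∈ 𝒞, boundary X M = boundary X C ∧ Disjoint M (boundary X D) := by
  have hsC := hC.star_star C h.1
  have hsD := hC.star_star D h'.1
  constructor
  · rintro ⟨E, F, hE, -, -, h2, -⟩
    obtain ⟨M, hM, hMC, hME⟩ := hC.exists_cut_side h hE
    exact ⟨M, hM, hMC, (Set.disjoint_iff_inter_eq_empty.2 h2).mono_left hME⟩
  · rintro ⟨M, hM, hMC, hMD⟩
    -- `M` lies on one side of `D`, so its boundary `NC` misses the opposite side. Applied a second
    -- time with the roles exchanged, this yields a corner with empty links.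
    have side : ∀ {C D M : Set V}, D ∈ thinCuts X 𝒞 → M ∈ 𝒞 → boundary X M = boundary X C →
        Disjoint M (boundary X D) → ∃ F, IsSide X D F ∧ Disjoint F (boundary X C) := by
      intro C D M hD hM hMC hMD
      rcases subset_side (hC.connected M hM) hMD with hs | hs
      · refine ⟨star X D, Or.inr rfl, Set.disjoint_left.2 fun v hv hvC => ?_⟩
        rcases boundary_subset_of_subset hs (hMC ▸ hvC) with h1 | h1
        · exact Set.disjoint_left.1 (disjoint_star X D) h1 hv
        · exact Set.disjoint_left.1 (disjoint_boundary_star X D) h1 hv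
      · refine ⟨D, Or.inl rfl, Set.disjoint_left.2 fun v hv hvC => ?_⟩
        rcases boundary_subset_of_subset hs (hMC ▸ hvC) with h1 | h1
        · exact Set.disjoint_left.1 (disjoint_star X D) hv h1
        · exact Set.disjoint_left.1 (disjoint_boundary X D) hv (boundary_star_subset X D h1)
    obtain ⟨F, hF, hFC⟩ := side h' hM hMC hMD
    obtain ⟨M', hM', hMD', hMF'⟩ := hC.exists_cut_side h' hF
    obtain ⟨E, hE, hED⟩ := side h hM' hMD' (hFC.mono_left hMF')
    -- If the separators coincide, `E ∩ F` may still contain a cut, so a corner that is literally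
    -- empty is chosen instead.
    by_cases hST : boundary X C = boundary X D
    · have hCD : Disjoint C (boundary X D) := hST ▸ disjoint_boundary X C
      have hDC : Disjoint D (boundary X C) := hST ▸ disjoint_boundary X D
      have hsd : Disjoint (star X D) (boundary X C) := hST ▸ (disjoint_boundary_star X D).symm
      have empt : ∀ {A B : Set V}, Disjoint A B → ¬ ContainsCut 𝒞 (A ∩ B) := by
        rintro A B hAB ⟨L, hL, hLe⟩
        rw [Set.disjoint_iff_inter_eq_empty.1 hAB] at hLe
        exact (hC.nonempty L hL).ne_empty (Set.subset_empty_iff.1 hLe)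
      rcases subset_side (hC.connected C h.1) hCD with hs | hs
      · exact ⟨C, star X D, Or.inl rfl, Or.inr rfl, empt ((disjoint_star X D).mono_left hs),
          Set.disjoint_iff_inter_eq_empty.1 hCD, Set.disjoint_iff_inter_eq_empty.1 hsd⟩
      · exact ⟨C, D, Or.inl rfl, Or.inl rfl, empt ((disjoint_star X D).symm.mono_left hs),
          Set.disjoint_iff_inter_eq_empty.1 hCD, Set.disjoint_iff_inter_eq_empty.1 hDC⟩
    · refine ⟨E, F, hE, hF, ?_, Set.disjoint_iff_inter_eq_empty.1 hED,
        Set.disjoint_iff_inter_eq_empty.1 hFC⟩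
      -- A cut in `E ∩ F` would lie in a component `K` of the complement of `NC` with `K ⊆ E ∩ F`.
      -- Then `NC = NK ⊆ F ∪ ND`, and as `F` misses `NC` the separators would agree.
      rintro ⟨H, hH, hHEF⟩
      apply hST
      have hHC : Disjoint H (boundary X C) := hFC.mono_left (hHEF.trans Set.inter_subset_right)
      obtain ⟨K, hK, hHK⟩ := exists_isComponent (A := (boundary X C)ᶜ) (hC.connected H hH)
        (Set.subset_compl_iff_disjoint_right.2 hHC)
      have hKi := isComponent_iff.1 hK
      have hKm := hC.mem_of_isComponent_compl h.1 hK ⟨H, hH, hHK⟩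
      have hKb := hC.boundary_eq_of_isComponent h hK hKm
      obtain ⟨x, hx⟩ := hC.nonempty H hH
      have hKE : K ⊆ E := connected_subset hKi.2.1
        (by rw [hE.boundary_eq hsC, ← hKb]; exact disjoint_boundary X K)
        ⟨x, hHK hx, (hHEF hx).1⟩
      have hKF : K ⊆ F := connected_subset hKi.2.1
        (by rw [hF.boundary_eq hsD]; exact hED.mono_left hKE) ⟨x, hHK hx, (hHEF hx).2⟩
      refine hC.boundary_eq_of_subset h' h.1 fun v hv => ?_
      rcases boundary_subset_of_subset hKF (hKb ▸ hv) with h1 | h1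
      · exact absurd hv (Set.disjoint_left.1 hFC h1)
      · rwa [hF.boundary_eq hsD] at h1

theorem nested_symm {C D : Set V} (h : Nested X 𝒞 C D) : Nested X 𝒞 D C := by
  obtain ⟨E, F, hE, hF, h1, h2, h3⟩ := h
  exact ⟨F, E, hF, hE, by rwa [Set.inter_comm], h3, h2⟩

end IsCutSystem

end CutSystems

/-! ### Uncrossing: optimally nested cuts are pairwise nested. -/

namespace CutSystems

variable {V : Type u} {X : SimpleGraph V} {𝒞 : Set (Set V)}

namespace IsCutSystem

theorem eq_of_boundary_eq (hC : IsCutSystem X 𝒞) {C D : Set V} (h : C ∈ 𝒞) (h' : D ∈ 𝒞)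
    (hb : boundary X C = boundary X D) (hne : (C ∩ D).Nonempty) : C = D :=
  (connected_subset (hC.connected C h) (hb ▸ disjoint_boundary X C) hne).antisymm
    (connected_subset (hC.connected D h') (hb ▸ disjoint_boundary X D)
      (Set.inter_comm C D ▸ hne))

theorem inter_nonempty_of_not_nested (hC : IsCutSystem X 𝒞) {C D M : Set V}
    (h : C ∈ thinCuts X 𝒞) (h' : D ∈ thinCuts X 𝒞) (hn : ¬ Nested X 𝒞 C D) (hM : M ∈ 𝒞)
    (hMC : boundary X M = boundary X C) : (M ∩ boundary X D).Nonempty := by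
  rw [hC.nested_iff h h'] at hn
  by_contra hcon
  exact hn ⟨M, hM, hMC, Set.disjoint_iff_inter_eq_empty.2 (Set.not_nonempty_iff_eq_empty.1 hcon)⟩

/-- Only finitely many thin cuts fail to be nested with a given thin cut. -/
theorem finite_not_nested (hC : IsCutSystem X 𝒞) {C : Set V} (h : C ∈ thinCuts X 𝒞) :
    {D | D ∈ thinCuts X 𝒞 ∧ ¬ Nested X 𝒞 C D}.Finite := by
  have hf := hC.finite_thin h
  have hfin : (⋃ x ∈ boundary X C, ⋃ y ∈ boundary X C, {D | D ∈ 𝒞 ∧ x ∈ D ∧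
      boundary X D ∈ tightSeparators X x y (boundary X C).ncard}).Finite := by
    refine hf.biUnion fun x _ => hf.biUnion fun y _ => ?_
    refine Set.Finite.of_finite_image
      ((finite_tightSeparators (boundary X C).ncard X x y).subset ?_) (f := boundary X) ?_
    · rintro _ ⟨D, hD, rfl⟩
      exact hD.2.2
    · intro D hD D' hD' hb
      exact hC.eq_of_boundary_eq hD.1 hD'.1 hb ⟨x, hD.2.1, hD'.2.1⟩
  refine hfin.subset ?_
  rintro D ⟨hD, hn⟩
  have hn' : ¬ Nested X 𝒞 D C := fun hh => hn (nested_symm hh)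
  obtain ⟨D', hD', hb, hs⟩ := hC.exists_cut_side hD (Or.inr rfl)
  -- `NC` meets both `D` and a cut `D' ⊆ D*` with the same separator, so `ND` tightly separates two
  -- vertices of `NC`; `ND` and `x` then determine `D`.
  obtain ⟨x, hx, hxC⟩ := hC.inter_nonempty_of_not_nested hD h hn' hD.1 rfl
  obtain ⟨y, hy, hyC⟩ := hC.inter_nonempty_of_not_nested hD h hn' hD' hb
  simp only [Set.mem_iUnion]
  refine ⟨x, hxC, y, hyC, hD.1, hx, hC.finite_thin hD, ?_, D, D', hC.connected D hD.1,
    hC.connected D' hD', hx, hy, (disjoint_star X D).mono_right hs, rfl, hb⟩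
  rw [Set.ncard_def, Set.ncard_def, encard_eq_thin h hD]

/-- A separator nested with `D` does not meet both sides of `D`. -/
theorem disjoint_side_of_nested (hC : IsCutSystem X 𝒞) {C D F : Set V} (h : C ∈ thinCuts X 𝒞)
    (h' : D ∈ thinCuts X 𝒞) (hF : IsSide X D F) (hn : Nested X 𝒞 C D) :
    Disjoint (boundary X C) F ∨ Disjoint (boundary X C) (star X F) := by
  have hsD := hC.star_star D h'.1
  obtain ⟨M, hM, hMC, hMD⟩ := (hC.nested_iff h h').1 hn
  rw [← hF.boundary_eq hsD] at hMD
  rcases subset_side (hC.connected M hM) hMD with hs | hs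
  · refine Or.inr (Set.disjoint_left.2 fun v hv hvF => ?_)
    rw [mem_star] at hvF
    rcases boundary_subset_of_subset hs (hMC ▸ hv) with h1 | h1 <;> tauto
  · refine Or.inl (Set.disjoint_left.2 fun v hv hvF => ?_)
    rcases boundary_subset_of_subset hs (hMC ▸ hv) with h1 | h1
    · exact Set.disjoint_left.1 (disjoint_star X F) hvF h1
    · exact Set.disjoint_left.1 (disjoint_boundary X F) hvF (boundary_star_subset X F h1)

/-- If the separators of `H` and `C` are nested then a cut `P` with the separator of `H` that meets
the separator of `C` contains all of it, up to the separator of `H`. -/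
theorem boundary_subset_of_nested (hC : IsCutSystem X 𝒞) {C H P : Set V}
    (h : C ∈ thinCuts X 𝒞) (h' : H ∈ thinCuts X 𝒞) (hn : Nested X 𝒞 H C)
    (hb : boundary X P = boundary X H) (hne : (boundary X C ∩ P).Nonempty) :
    boundary X C ⊆ P ∪ boundary X H := by
  obtain ⟨M, hM, hMC, hMH⟩ := (hC.nested_iff h h').1 (nested_symm hn)
  rw [← hMC] at hne ⊢
  rw [← hb] at hMH ⊢
  exact boundary_subset_of_subset (connected_subset_of_boundary (hC.connected M hM) hMH hne)

/-- A cut nested with both of the crossing cuts `C` and `D` is nested with the cuts in the corners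
of `C` and `D`. -/
theorem nested_corner (hC : IsCutSystem X 𝒞) {C D E F H K K' : Set V} (h : C ∈ thinCuts X 𝒞)
    (h' : D ∈ thinCuts X 𝒞) (hH : H ∈ thinCuts X 𝒞) (hn : ¬ Nested X 𝒞 C D)
    (hE : IsSide X C E) (hF : IsSide X D F) (hK : K ∈ thinCuts X 𝒞) (hKs : K ⊆ E ∩ F)
    (hKb : boundary X K = cornerBoundary X E F) (hK' : K' ∈ 𝒞)
    (hKs' : K' ⊆ star X E ∩ star X F)
    (hKb' : boundary X K' = cornerBoundary X (star X E) (star X F))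
    (hHC : Nested X 𝒞 H C) (hHD : Nested X 𝒞 H D) : Nested X 𝒞 H K := by
  have hsC := hC.star_star C h.1
  have hsD := hC.star_star D h'.1
  by_contra hHK
  obtain ⟨H', hH', hHb', hHs'⟩ := hC.exists_cut_side hH (Or.inr rfl)
  have hHH' : Disjoint H H' := (disjoint_star X H).mono_right hHs'
  obtain ⟨r, hrK, hrH⟩ := hC.inter_nonempty_of_not_nested hK hH
    (fun hh => hHK (nested_symm hh)) hK.1 rfl
  -- `H` misses the far sides of `C` and `D`
  have hdE : Disjoint (boundary X H) (star X E) :=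
    (hC.disjoint_side_of_nested hH h hE hHC).resolve_left
      fun hd => Set.disjoint_left.1 hd hrH (hKs hrK).1
  have hdF : Disjoint (boundary X H) (star X F) :=
    (hC.disjoint_side_of_nested hH h' hF hHD).resolve_left
      fun hd => Set.disjoint_left.1 hd hrH (hKs hrK).2
  have hKH' : Disjoint K' (boundary X H) :=
    (hdE.mono_right (hKs'.trans Set.inter_subset_left)).symm
  obtain ⟨MC, hMC, hMCb, hMCs⟩ := hC.exists_cut_side h (hE.star_right hsC)
  obtain ⟨MD, hMD, hMDb, hMDs⟩ := hC.exists_cut_side h' (hF.star_right hsD)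
  -- Because `C` and `D` cross, both links of the far corner are non-empty. They give `t ∈ ND` and
  -- `s ∈ NC`, both adjacent to `K'` and off `NH`.
  obtain ⟨t, htM, htD⟩ := hC.inter_nonempty_of_not_nested h h' hn hMC hMCb
  obtain ⟨s, hsM, hsCs⟩ := hC.inter_nonempty_of_not_nested h' h
    (fun hh => hn (nested_symm hh)) hMD hMDb
  have htH : t ∉ boundary X H := fun hh => Set.disjoint_left.1 hdE hh (hMCs htM)
  have hsH : s ∉ boundary X H := fun hh => Set.disjoint_left.1 hdF hh (hMDs hsM)
  have htK' : t ∈ boundary X K' := by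
    rw [hKb', cornerBoundary, boundary_star (hF.star_star hsD), hF.boundary_eq hsD]
    exact Or.inl (Or.inl ⟨hMCs htM, htD⟩)
  have hsK' : s ∈ boundary X K' := by
    rw [hKb', cornerBoundary, boundary_star (hE.star_star hsC), hE.boundary_eq hsC]
    exact Or.inr ⟨hMDs hsM, hsCs⟩
  -- `K'` joins the two separators in the complement of the separator of `H`
  have key : ∀ {P P' : Set V}, boundary X P = boundary X H → boundary X P' = boundary X H →
      Disjoint P P' → (boundary X C ∩ P).Nonempty → ¬ (boundary X D ∩ P').Nonempty := by
    intro P P' hP hP' hPP' hne hne'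
    have hsP := (hC.boundary_subset_of_nested h hH hHC hP hne hsCs).resolve_right hsH
    have htP := (hC.boundary_subset_of_nested h' hH hHD hP' hne' htD).resolve_right htH
    have h1 := connected_subset_of_boundary (hC.connected K' hK') (hP ▸ hKH') ⟨s, hsK', hsP⟩
    have h2 := connected_subset_of_boundary (hC.connected K' hK') (hP' ▸ hKH') ⟨t, htK', htP⟩
    obtain ⟨x, hx⟩ := hC.nonempty K' hK'
    exact Set.disjoint_left.1 hPP' (h1 hx) (h2 hx)
  have key' : ∀ {S : Set V}, S ∈ thinCuts X 𝒞 → Nested X 𝒞 H S →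
      (boundary X S ∩ H).Nonempty → ¬ (boundary X S ∩ H').Nonempty := by
    rintro S hS hHS hne ⟨x, hxS, hx⟩
    rcases hC.boundary_subset_of_nested hS hH hHS rfl hne hxS with h1 | h1
    · exact Set.disjoint_left.1 hHH' h1 hx
    · rw [← hHb'] at h1
      exact h1.1 hx
  have hU : ∀ v ∈ boundary X K, v ∈ boundary X C ∨ v ∈ boundary X D := by
    intro v hv
    rw [hKb, cornerBoundary, hE.boundary_eq hsC, hF.boundary_eq hsD] at hv
    rcases hv with (hv | hv) | hv
    · exact Or.inr hv.2
    · exact Or.inl hv.1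
    · exact Or.inl hv.2
  -- `NK ⊆ NC ∪ ND` meets both `H` and `H'`. By `key'` neither `NC` nor `ND` alone meets both; by
  -- `key` they cannot share them out either.
  obtain ⟨a, haH, haK⟩ := hC.inter_nonempty_of_not_nested hH hK hHK hH.1 rfl
  obtain ⟨b, hbH, hbK⟩ := hC.inter_nonempty_of_not_nested hH hK hHK hH' hHb'
  rcases hU a haK with ha | ha <;> rcases hU b hbK with hb | hb
  · exact key' h hHC ⟨a, ha, haH⟩ ⟨b, hb, hbH⟩
  · exact key rfl hHb' hHH' ⟨a, ha, haH⟩ ⟨b, hb, hbH⟩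
  · exact key hHb' rfl hHH'.symm ⟨b, hb, hbH⟩ ⟨a, ha, haH⟩
  · exact key' h' hHD ⟨a, ha, haH⟩ ⟨b, hb, hbH⟩

/-- A cut nested with `C` is nested with a given cut on one of the two sides of `C`. -/
theorem nested_or_nested (hC : IsCutSystem X 𝒞) {C E H K K' : Set V} (h : C ∈ thinCuts X 𝒞)
    (hH : H ∈ thinCuts X 𝒞) (hE : IsSide X C E) (hK : K ∈ thinCuts X 𝒞) (hKs : K ⊆ E)
    (hK' : K' ∈ thinCuts X 𝒞) (hKs' : K' ⊆ star X E) (hn : Nested X 𝒞 H C) :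
    Nested X 𝒞 H K ∨ Nested X 𝒞 H K' := by
  rcases hC.disjoint_side_of_nested hH h hE hn with hd | hd
  · exact Or.inl (nested_symm ((hC.nested_iff hK hH).2 ⟨K, hK.1, rfl, (hd.mono_right hKs).symm⟩))
  · exact Or.inr (nested_symm ((hC.nested_iff hK' hH).2
      ⟨K', hK'.1, rfl, (hd.mono_right hKs').symm⟩))

theorem nested_of_subset_side (hC : IsCutSystem X 𝒞) {C E K : Set V} (h : C ∈ thinCuts X 𝒞)
    (hE : IsSide X C E) (hK : K ∈ thinCuts X 𝒞) (hKs : K ⊆ E) : Nested X 𝒞 K C := by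
  refine (hC.nested_iff hK h).2 ⟨K, hK.1, rfl, ?_⟩
  rw [← hE.boundary_eq (hC.star_star C h.1)]
  exact (disjoint_boundary X E).mono_left hKs

/-- Two thin cuts that are not nested can be uncrossed, which lowers the total of `μ`. -/
theorem exists_mu_add_lt (hC : IsCutSystem X 𝒞) {C D : Set V} (h : C ∈ thinCuts X 𝒞)
    (h' : D ∈ thinCuts X 𝒞) (hn : ¬ Nested X 𝒞 C D) :
    ∃ K ∈ thinCuts X 𝒞, ∃ K' ∈ thinCuts X 𝒞,
      mu X 𝒞 K + mu X 𝒞 K' < mu X 𝒞 C + mu X 𝒞 D := by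
  have hsC := hC.star_star C h.1
  have hsD := hC.star_star D h'.1
  have hE : IsSide X C C := IsSide.refl X C
  obtain ⟨F, hF, h1, h2⟩ := hC.exists_corners h.1 h'.1 hE
  obtain ⟨K, hKc, hKcut⟩ := hC.exists_component_containsCut h1
  obtain ⟨K', hKc', hKcut'⟩ := hC.exists_component_containsCut h2
  have hss : star X (star X C) ∩ star X (star X F) = C ∩ F := by
    rw [hsC, hF.star_star hsD]
  obtain ⟨hK, hKb⟩ := hC.corner_thin h h' hE hF h2 hKc hKcut
  obtain ⟨hK', hKb'⟩ := hC.corner_thin h h' (hE.star_right hsC) (hF.star_right hsD)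
    (by rwa [hss]) hKc' hKcut'
  have hKs := (isComponent_iff.1 hKc).1
  have hKs' := (isComponent_iff.1 hKc').1
  refine ⟨K, hK, K', hK', ?_⟩
  have symm : ∀ {A B : Set V}, ¬ Nested X 𝒞 A B → ¬ Nested X 𝒞 B A :=
    fun hAB hBA => hAB (nested_symm hBA)
  have hcr : ∀ {H}, H ∈ thinCuts X 𝒞 → Nested X 𝒞 H C → Nested X 𝒞 H D →
      Nested X 𝒞 H K ∧ Nested X 𝒞 H K' := by
    intro H hH hHC hHD
    exact ⟨hC.nested_corner h h' hH hn hE hF hK hKs hKb hK'.1 hKs' hKb' hHC hHD,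
      hC.nested_corner h h' hH hn (hE.star_right hsC) (hF.star_right hsD) hK' hKs' hKb' hK.1
        (by rwa [hss]) (by rwa [hsC, hF.star_star hsD]) hHC hHD⟩
  simp only [mu]
  set cr : Set V → Set (Set V) := fun A => {H | H ∈ thinCuts X 𝒞 ∧ ¬ Nested X 𝒞 A H} with hcrd
  have hfC : (cr C).Finite := hC.finite_not_nested h
  have hfD : (cr D).Finite := hC.finite_not_nested h'
  have hinter : cr K ∩ cr K' ⊆ cr C ∩ cr D := by
    rintro H ⟨⟨hH, hHK⟩, -, hHK'⟩
    refine ⟨⟨hH, fun hh => ?_⟩, hH, fun hh => ?_⟩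
    · rcases hC.nested_or_nested h hH hE hK (hKs.trans Set.inter_subset_left) hK'
        (hKs'.trans Set.inter_subset_left) (nested_symm hh) with h3 | h3
      · exact symm hHK h3
      · exact symm hHK' h3
    · rcases hC.nested_or_nested h' hH hF hK (hKs.trans Set.inter_subset_right) hK'
        (hKs'.trans Set.inter_subset_right) (nested_symm hh) with h3 | h3
      · exact symm hHK h3
      · exact symm hHK' h3
  have hunion : cr K ∪ cr K' ⊂ cr C ∪ cr D := by
    refine ⟨?_, fun hsub => ?_⟩
    · intro H hHm
      by_contra hcon
      have hH : H ∈ thinCuts X 𝒞 := hHm.elim (fun x => x.1) (fun x => x.1)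
      have h3 : Nested X 𝒞 C H := by_contra fun hh => hcon (Or.inl ⟨hH, hh⟩)
      have h4 : Nested X 𝒞 D H := by_contra fun hh => hcon (Or.inr ⟨hH, hh⟩)
      obtain ⟨h5, h6⟩ := hcr hH (nested_symm h3) (nested_symm h4)
      exact hHm.elim (fun x => x.2 (nested_symm h5)) (fun x => x.2 (nested_symm h6))
    -- Strictness: `C` itself crosses `D`, but is nested with cuts lying on a side of `C`.
    · have hCm : C ∈ cr C ∪ cr D := Or.inr ⟨h, symm hn⟩
      rcases hsub hCm with h3 | h3
      · exact h3.2 (hC.nested_of_subset_side h hE hK (hKs.trans Set.inter_subset_left))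
      · exact h3.2 (hC.nested_of_subset_side h (hE.star_right hsC) hK'
          (hKs'.trans Set.inter_subset_left))
  have hfu := hfC.union hfD
  have hlt := (hfu.subset hunion.subset).encard_lt_encard hunion
  have hle := Set.encard_le_encard hinter
  have hfi := hfC.subset (Set.inter_subset_left (t := cr D))
  change (cr K).encard + (cr K').encard < (cr C).encard + (cr D).encard
  rw [← Set.encard_union_add_encard_inter (cr K), ← Set.encard_union_add_encard_inter (cr C)]
  exact (add_le_add_right hle _).trans_lt ((ENat.add_lt_add_iff_right hfi.encard_lt_top.ne).2 hlt)

/-- Optimally nested thin cuts are pairwise nested. -/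
theorem nested_of_optimallyNested (hC : IsCutSystem X 𝒞) {C D : Set V}
    (h : C ∈ optimallyNested X 𝒞) (h' : D ∈ optimallyNested X 𝒞) : Nested X 𝒞 C D := by
  by_contra hn
  obtain ⟨K, hK, K', hK', hlt⟩ := hC.exists_mu_add_lt h.1 h'.1 hn
  exact absurd hlt (not_lt.2 (add_le_add (h.2 K hK) (h'.2 K' hK')))

/-- The criterion `nested_iff` sees `C` only through its separator. -/
theorem mu_congr (hC : IsCutSystem X 𝒞) {C D : Set V} (h : C ∈ thinCuts X 𝒞)
    (h' : D ∈ thinCuts X 𝒞) (hb : boundary X C = boundary X D) : mu X 𝒞 C = mu X 𝒞 D := by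
  unfold mu
  congr 1
  ext H
  refine and_congr_right fun hH => not_congr ?_
  rw [hC.nested_iff h hH, hC.nested_iff h' hH, hb]

/-- Being optimally nested only depends on the separator of a cut. -/
theorem optimallyNested_of_boundary_eq (hC : IsCutSystem X 𝒞) {C D : Set V}
    (h : C ∈ optimallyNested X 𝒞) (h' : D ∈ 𝒞) (hb : boundary X D = boundary X C) :
    D ∈ optimallyNested X 𝒞 := by
  have hD : D ∈ thinCuts X 𝒞 := thin_of_encard_le h.1 h' (by rw [hb])
  refine ⟨hD, fun E hE => ?_⟩
  rw [hC.mu_congr hD h.1 hb]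
  exact h.2 E hE

theorem exists_thin (hne : 𝒞.Nonempty) : (thinCuts X 𝒞).Nonempty := by
  obtain ⟨C, hC, hmin⟩ := exists_minimalFor_of_wellFoundedLT (· ∈ 𝒞)
    (fun C => (boundary X C).encard) hne
  exact ⟨C, hC, fun D hD => (le_total _ _).elim id (fun hh => hmin hD hh)⟩

theorem exists_optimallyNested (hne : 𝒞.Nonempty) : (optimallyNested X 𝒞).Nonempty := by
  obtain ⟨C, hC, hmin⟩ := exists_minimalFor_of_wellFoundedLT (· ∈ thinCuts X 𝒞)
    (mu X 𝒞) (exists_thin hne)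
  exact ⟨C, hC, fun D hD => (le_total _ _).elim id (fun hh => hmin hD hh)⟩

end IsCutSystem

end CutSystems

/-! ### Nested families, and the cut system axioms for optimally nested cuts. -/

namespace CutSystems

variable {V : Type u} {X : SimpleGraph V} {𝒞 𝒩 : Set (Set V)}

/-- `C` is the component of the complement of its separator towards the separator `T`. -/
def Faces (X : SimpleGraph V) (C T : Set V) : Prop :=
  T ≠ boundary X C ∧ T ⊆ C ∪ boundary X C

/-- A family of connected sets with finite boundaries of the same size, such that of the components
of the complement of any boundary at least two and all that meet another boundary belong to the
family, and at most one meets a given other boundary. -/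
structure IsNestedFamily (X : SimpleGraph V) (𝒩 : Set (Set V)) : Prop where
  connected : ∀ C ∈ 𝒩, (X.induce C).Connected
  finite_boundary : ∀ C ∈ 𝒩, (boundary X C).Finite
  nonempty_boundary : ∀ C ∈ 𝒩, (boundary X C).Nonempty
  encard_eq : ∀ C ∈ 𝒩, ∀ D ∈ 𝒩, (boundary X C).encard = (boundary X D).encard
  exists_other : ∀ C ∈ 𝒩, ∃ C' ∈ 𝒩, boundary X C' = boundary X C ∧ C' ⊆ star X C
  exists_faces : ∀ C ∈ 𝒩, ∀ D ∈ 𝒩, boundary X D ≠ boundary X C →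
    ∃ E ∈ 𝒩, boundary X E = boundary X C ∧ Faces X E (boundary X D)
  disjoint_slice : ∀ C ∈ 𝒩, ∀ D ∈ 𝒩, ∀ Q, IsComponent X (boundary X C)ᶜ Q → Q ∉ 𝒩 →
    Disjoint Q (boundary X D)

namespace IsNestedFamily

theorem eq_of_boundary_eq (hN : IsNestedFamily X 𝒩) {C D : Set V} (h : C ∈ 𝒩) (h' : D ∈ 𝒩)
    (hb : boundary X C = boundary X D) (hne : (C ∩ D).Nonempty) : C = D :=
  (connected_subset (hN.connected C h) (hb ▸ disjoint_boundary X C) hne).antisymm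
    (connected_subset (hN.connected D h') (hb ▸ disjoint_boundary X D)
      (Set.inter_comm C D ▸ hne))

theorem disjoint_of_ne (hN : IsNestedFamily X 𝒩) {C D : Set V} (h : C ∈ 𝒩) (h' : D ∈ 𝒩)
    (hb : boundary X C = boundary X D) (hne : C ≠ D) : Disjoint C D :=
  Set.disjoint_left.2 fun x hx hx' => hne (hN.eq_of_boundary_eq h h' hb ⟨x, hx, hx'⟩)

theorem subset_star_of_ne (hN : IsNestedFamily X 𝒩) {C D : Set V} (h : C ∈ 𝒩) (h' : D ∈ 𝒩)
    (hb : boundary X C = boundary X D) (hne : C ≠ D) : D ⊆ star X C :=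
  subset_star_of_disjoint (hN.disjoint_of_ne h h' hb hne).symm (hb ▸ disjoint_boundary X D)

theorem boundary_eq_of_subset (hN : IsNestedFamily X 𝒩) {C D : Set V} (h : C ∈ 𝒩) (h' : D ∈ 𝒩)
    (hs : boundary X C ⊆ boundary X D) : boundary X C = boundary X D :=
  (hN.finite_boundary D h').eq_of_subset_of_encard_le' hs (hN.encard_eq D h' C h).le

/-- Distinct finite sets of equal size cannot contain one another. -/
theorem exists_mem_diff (hN : IsNestedFamily X 𝒩) {C D : Set V} (h : C ∈ 𝒩) (h' : D ∈ 𝒩)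
    (hb : boundary X C ≠ boundary X D) : ∃ x ∈ boundary X C, x ∉ boundary X D := by
  by_contra! hcon
  exact hb (hN.boundary_eq_of_subset h h' hcon)

theorem exists_mem_of_faces (hN : IsNestedFamily X 𝒩) {C D : Set V} (h : C ∈ 𝒩) (h' : D ∈ 𝒩)
    (hf : Faces X C (boundary X D)) : ∃ x ∈ boundary X D, x ∉ boundary X C ∧ x ∈ C := by
  obtain ⟨x, hx, hx'⟩ := hN.exists_mem_diff h' h hf.1
  exact ⟨x, hx, hx', (hf.2 hx).resolve_right hx'⟩

theorem faces_unique (hN : IsNestedFamily X 𝒩) {C C' D : Set V} (h : C ∈ 𝒩) (h' : C' ∈ 𝒩)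
    (hD : D ∈ 𝒩) (hb : boundary X C = boundary X C') (hf : Faces X C (boundary X D))
    (hf' : Faces X C' (boundary X D)) : C = C' := by
  obtain ⟨x, hx, hxC, hxm⟩ := hN.exists_mem_of_faces h hD hf
  exact hN.eq_of_boundary_eq h h' hb ⟨x, hxm, (hf'.2 hx).resolve_right (hb ▸ hxC)⟩

theorem disjoint_of_faces_other (hN : IsNestedFamily X 𝒩) {C C' T : Set V} (h : C ∈ 𝒩)
    (h' : C' ∈ 𝒩) (hb : boundary X C = boundary X C') (hne : C ≠ C') (hf : Faces X C' T) :
    Disjoint C T :=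
  Set.disjoint_left.2 fun x hx hxT => (hf.2 hxT).elim
    (fun hx' => hne (hN.eq_of_boundary_eq h h' hb ⟨x, hx, hx'⟩))
    (fun hx' => Set.disjoint_left.1 (disjoint_boundary X C) hx (hb ▸ hx'))

/-- A member of the family that faces away from the separator of `F` lies in `F` if `F` faces it. -/
theorem subset_of_faces (hN : IsNestedFamily X 𝒩) {E E' F : Set V} (h : E ∈ 𝒩) (h' : E' ∈ 𝒩)
    (hF : F ∈ 𝒩) (hb : boundary X E = boundary X E') (hne : E ≠ E')
    (hf : Faces X E' (boundary X F)) (hfF : Faces X F (boundary X E)) : E ⊆ F := by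
  obtain ⟨x, hx, -, hxF⟩ := hN.exists_mem_of_faces hF h hfF
  exact connected_subset_of_boundary (hN.connected E h)
    (hN.disjoint_of_faces_other h h' hb hne hf) ⟨x, hx, hxF⟩

/-- If a separator lies between those of `C` and `D`, then `C` faces it if `C` faces `D`. -/
theorem faces_of_between (hN : IsNestedFamily X 𝒩) {C D E E' : Set V} (h : C ∈ 𝒩) (h' : D ∈ 𝒩)
    (hE : E ∈ 𝒩) (hE' : E' ∈ 𝒩) (hb : boundary X E = boundary X E') (hne : E ≠ E')
    (hfE : Faces X E (boundary X C)) (hfE' : Faces X E' (boundary X D))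
    (hf : Faces X C (boundary X D)) : Faces X C (boundary X E) := by
  obtain ⟨C₁, hC₁, hb₁, hf₁⟩ := hN.exists_faces C h E hE (Ne.symm hfE.1)
  by_cases hCC : C = C₁
  · rwa [hCC]
  exfalso
  -- If `C` faced away from `NE` it would lie in `E`. But `C` contains a vertex of `ND`, while `E`
  -- misses `ND`, which another member at that separator faces.
  have hCE : C ⊆ E := hN.subset_of_faces h hC₁ hE hb₁.symm hCC hf₁ hfE
  obtain ⟨y, hy, hyC, hyC'⟩ := hN.exists_mem_of_faces h h' hf
  exact Set.disjoint_left.1 (hN.disjoint_of_faces_other hE hE' hb hne hfE') (hCE hyC') hy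

end IsNestedFamily

namespace IsCutSystem

theorem isNestedFamily_optimallyNested (hX : X.Connected) (hC : IsCutSystem X 𝒞) :
    IsNestedFamily X (optimallyNested X 𝒞) where
  connected C h := hC.connected C h.1.1
  finite_boundary C h := hC.finite_thin h.1
  nonempty_boundary C h := by
    refine boundary_nonempty hX (hC.nonempty C h.1.1) fun hu => ?_
    obtain ⟨M, hM, hMs⟩ := hC.containsCut_star h.1.1
    obtain ⟨x, hx⟩ := hC.nonempty M hM
    exact (mem_star.1 (hMs hx)).1 (hu ▸ Set.mem_univ x)
  encard_eq C h D h' := encard_eq_thin h.1 h'.1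
  exists_other C h := by
    obtain ⟨M, hM, hb, hs⟩ := hC.exists_cut_side h.1 (Or.inr rfl)
    exact ⟨M, hC.optimallyNested_of_boundary_eq h hM hb, hb, hs⟩
  exists_faces C h D h' hne := by
    -- `M` has separator `ND` and avoids `NC`, so it lies in the component `Q` of the complement of
    -- `NC` that meets `ND`, and its boundary `ND` lies in `Q ∪ NC`.
    obtain ⟨M, hM, hMb, hMd⟩ := (hC.nested_iff h'.1 h.1).1 (hC.nested_of_optimallyNested h' h)
    obtain ⟨t, ht, htC⟩ : ∃ t ∈ boundary X D, t ∉ boundary X C := by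
      by_contra! hcon
      exact hne (hC.boundary_eq_of_subset h.1 h'.1.1 hcon)
    obtain ⟨Q, hQ, htQ⟩ := exists_isComponent_mem X (A := (boundary X C)ᶜ) htC
    have hQm : Q ∈ 𝒞 := by
      by_contra hcon
      exact Set.disjoint_left.1 (hC.disjoint_slice_boundary h.1 h'.1 hQ hcon) htQ ht
    have hQb := hC.boundary_eq_of_isComponent h.1 hQ hQm
    refine ⟨Q, hC.optimallyNested_of_boundary_eq h hQm hQb, hQb, by rwa [hQb], ?_⟩
    rw [← hMb]
    exact boundary_subset_of_subset (connected_subset_of_boundary (hC.connected M hM)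
      (by rwa [hQb]) ⟨t, by rwa [hMb], htQ⟩)
  disjoint_slice C h D h' Q hQ hQn := by
    refine hC.disjoint_slice_boundary h.1 h'.1 hQ fun hQm => hQn ?_
    exact hC.optimallyNested_of_boundary_eq h hQm (hC.boundary_eq_of_isComponent h.1 hQ hQm)

end IsCutSystem

/-- This is A2. For distinct separators let `Y` and `Z` be the members at `NC` and `ND` that face
each other. All other members at `NC` lie in `Z` and all others at `ND` lie in `Y`, so the corners
can be read off from whether `C = Y` and `D = Z`. -/
theorem IsNestedFamily.exists_opposite (hN : IsNestedFamily X 𝒩) {C D : Set V} (h : C ∈ 𝒩)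
    (h' : D ∈ 𝒩) : ∃ A B : Set V, OppositeCorners X C D A B ∧
      ContainsCut 𝒩 A ∧ ContainsCut 𝒩 B := by
  obtain ⟨C', hC', hCb, hCs⟩ := hN.exists_other C h
  obtain ⟨D', hD', hDb, hDs⟩ := hN.exists_other D h'
  have hCC : C' ≠ C := by
    rintro rfl
    obtain ⟨x, hx⟩ := nonempty_of_connected (hN.connected C' h)
    exact (mem_star.1 (hCs hx)).1 hx
  have hDD : D' ≠ D := by
    rintro rfl
    obtain ⟨x, hx⟩ := nonempty_of_connected (hN.connected D' h')
    exact (mem_star.1 (hDs hx)).1 hx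
  by_cases hST : boundary X C = boundary X D
  · by_cases hCD : C = D
    · subst hCD
      exact ⟨_, _, Or.inl ⟨rfl, rfl⟩, ⟨C, h, by simp⟩, ⟨C', hC', by simpa using hCs⟩⟩
    · exact ⟨_, _, Or.inr (Or.inr (Or.inl ⟨rfl, rfl⟩)),
        ⟨C, h, Set.subset_inter subset_rfl (hN.subset_star_of_ne h' h hST.symm (Ne.symm hCD))⟩,
        ⟨D, h', Set.subset_inter (hN.subset_star_of_ne h h' hST hCD) subset_rfl⟩⟩
  obtain ⟨Y, hY, hYb, hYf⟩ := hN.exists_faces C h D h' (Ne.symm hST)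
  obtain ⟨Z, hZ, hZb, hZf⟩ := hN.exists_faces D h' C h hST
  have hCZ : ∀ {C₁}, C₁ ∈ 𝒩 → boundary X C₁ = boundary X C → C₁ ≠ Y → C₁ ⊆ Z := fun h1 hb hne =>
    hN.subset_of_faces h1 hY hZ (hb.trans hYb.symm) hne (hZb ▸ hYf) (hb ▸ hZf)
  have hDY : ∀ {D₁}, D₁ ∈ 𝒩 → boundary X D₁ = boundary X D → D₁ ≠ Z → D₁ ⊆ Y := fun h1 hb hne =>
    hN.subset_of_faces h1 hZ hY (hb.trans hZb.symm) hne (hYb ▸ hZf) (hb ▸ hYf)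
  by_cases hCY : C = Y <;> by_cases hDZ : D = Z
  · subst hCY hDZ
    exact ⟨_, _, Or.inr (Or.inr (Or.inl ⟨rfl, rfl⟩)),
      ⟨D', hD', Set.subset_inter (hDY hD' hDb hDD) hDs⟩,
      ⟨C', hC', Set.subset_inter hCs (hCZ hC' hCb hCC)⟩⟩
  · subst hCY
    exact ⟨_, _, Or.inl ⟨rfl, rfl⟩,
      ⟨D, h', Set.subset_inter (hDY h' rfl hDZ) subset_rfl⟩,
      ⟨C', hC', Set.subset_inter hCs ((hCZ hC' hCb hCC).trans
        (hN.subset_star_of_ne h' hZ hZb.symm hDZ))⟩⟩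
  · subst hDZ
    exact ⟨_, _, Or.inl ⟨rfl, rfl⟩,
      ⟨C, h, Set.subset_inter subset_rfl (hCZ h rfl hCY)⟩,
      ⟨D', hD', Set.subset_inter ((hDY hD' hDb hDD).trans
        (hN.subset_star_of_ne h hY hYb.symm hCY)) hDs⟩⟩
  · exact ⟨_, _, Or.inr (Or.inr (Or.inl ⟨rfl, rfl⟩)),
      ⟨C, h, Set.subset_inter subset_rfl ((hCZ h rfl hCY).trans
        (hN.subset_star_of_ne h' hZ hZb.symm hDZ))⟩,
      ⟨D, h', Set.subset_inter ((hDY h' rfl hDZ).trans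
        (hN.subset_star_of_ne h hY hYb.symm hCY)) subset_rfl⟩⟩

/-- The optimally nested thin cuts form a cut system. -/
theorem IsCutSystem.isCutSystem_optimallyNested (hX : X.Connected) (hC : IsCutSystem X 𝒞) :
    IsCutSystem X (optimallyNested X 𝒞) where
  nonempty C h := hC.nonempty C h.1.1
  connected C h := hC.connected C h.1.1
  finite_boundary C h := hC.finite_thin h.1
  star_star C h := hC.star_star C h.1.1
  A2 C h D h' := (hC.isNestedFamily_optimallyNested hX).exists_opposite h h'
  A1 C h D h' A B hAB hA hB K hK hKc := by
    have hsC := hC.star_star C h.1.1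
    have hsD := hC.star_star D h'.1.1
    obtain ⟨E, F, hE, hF, rfl, rfl⟩ := exists_isSide_of_opposite hsC hsD hAB
    have up : ∀ {W}, ContainsCut (optimallyNested X 𝒞) W → ContainsCut 𝒞 W :=
      fun ⟨L, hL, hs⟩ => ⟨L, hL.1.1, hs⟩
    obtain ⟨hKt, hKb⟩ := hC.corner_thin h.1 h'.1 hE hF (up hB) hK (up hKc)
    rw [cornerBoundary, hE.boundary_eq hsC, hF.boundary_eq hsD] at hKb
    -- `ND` misses a side of `C`. If it misses `E`, then `NK ⊆ NC`; if it misses `E*`, then `ND ⊆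
    -- NK`. Minimal size turns either inclusion into equality, and optimality depends only on the
    -- separator.
    rcases hC.disjoint_side_of_nested h'.1 h.1 hE (hC.nested_of_optimallyNested h' h) with hd | hd
    · refine hC.optimallyNested_of_boundary_eq h hKt.1 (hC.boundary_eq_of_subset h.1 hKt.1 ?_)
      rw [hKb]
      rintro v ((hv | hv) | hv)
      · exact absurd hv.1 (Set.disjoint_left.1 hd hv.2)
      · exact hv.1
      · exact hv.2
    · refine hC.optimallyNested_of_boundary_eq h' hKt.1
        (hC.boundary_eq_of_subset hKt h'.1.1 ?_).symm
      rw [hKb]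
      intro v hv
      have := Set.disjoint_left.1 hd hv
      rw [mem_star, hE.boundary_eq hsC] at this
      simp only [Set.mem_union, Set.mem_inter_iff]
      tauto

end CutSystems

/-! ### The graph `X̂` and the relation `∼`. -/

namespace CutSystems

variable {V : Type u} {X : SimpleGraph V} {𝒩 : Set (Set V)}

/-- Some separator lies strictly between the separators `S` and `T`. -/
def Separated (X : SimpleGraph V) (𝒩 : Set (Set V)) (S T : Set V) : Prop :=
  ∃ E ∈ 𝒩, ∃ E' ∈ 𝒩, boundary X E = boundary X E' ∧ E ≠ E' ∧ Faces X E S ∧ Faces X E' T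

namespace IsNestedFamily

theorem mem_hatVertices_of_mem_boundary (hN : IsNestedFamily X 𝒩) {D : Set V} (h : D ∈ 𝒩) {v : V}
    (hv : v ∈ boundary X D) : v ∈ hatVertices X 𝒩 := by
  rintro Q ⟨hQ, C, hC, hQC⟩ hvQ
  exact Set.disjoint_left.1 (hN.disjoint_slice C hC D h Q hQC hQ) hvQ hv

theorem exists_mem_of_mem_hatVertices (hN : IsNestedFamily X 𝒩) {C : Set V} (h : C ∈ 𝒩) {v : V}
    (hv : v ∈ hatVertices X 𝒩) (hvC : v ∉ boundary X C) :
    ∃ Q ∈ 𝒩, boundary X Q = boundary X C ∧ v ∈ Q := by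
  obtain ⟨Q, hQ, hvQ⟩ := exists_isComponent_mem X (A := (boundary X C)ᶜ) hvC
  have hQm : Q ∈ 𝒩 := by
    by_contra hcon
    exact hv Q ⟨hcon, C, h, hQ⟩ hvQ
  refine ⟨Q, hQm, hN.boundary_eq_of_subset hQm h ?_, hvQ⟩
  simpa using Set.subset_compl_iff_disjoint_left.2 (isComponent_iff.1 hQ).2.2

/-- A new edge has both ends in one separator, which lies in `C ∪ NC` as soon as it meets `C`; so no
boundary vertices are gained. None is lost: if a neighbour in `C` of `v ∈ NC` is deleted with a
slice `Q`, then `Q ⊆ C` and a new edge joins `v` to a vertex of `NQ` in `C`. -/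
theorem boundary_hatCut (hN : IsNestedFamily X 𝒩) {C : Set V} (h : C ∈ 𝒩) :
    boundary (hatGraph X 𝒩) (hatCut X 𝒩 C) =
      {v : hatVertices X 𝒩 | (v : V) ∈ boundary X C} := by
  ext v
  constructor
  · rintro ⟨hv, w, hw, -, hwv | ⟨Q, ⟨hQn, T, hT, hQT⟩, hwQ, hvQ⟩⟩
    · exact ⟨hv, w, hw, hwv⟩
    · have hQT' : boundary X Q ⊆ boundary X T := by
        simpa using Set.subset_compl_iff_disjoint_left.2 (isComponent_iff.1 hQT).2.2
      have hne : boundary X T ≠ boundary X C := fun he =>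
        Set.disjoint_left.1 (disjoint_boundary X C) hw (he ▸ hQT' hwQ)
      obtain ⟨E, hE, hEb, -, hEf⟩ := hN.exists_faces C h T hT hne
      have hEC : E = C := by
        refine hN.eq_of_boundary_eq hE h hEb ⟨w, (hEf (hQT' hwQ)).resolve_right fun hh => ?_, hw⟩
        rw [hEb] at hh
        exact hh.1 hw
      rw [hEC] at hEf
      exact (hEf (hQT' hvQ)).resolve_left hv
  · intro hv
    obtain ⟨hvC, u, hu, huv⟩ := (hv : (v : V) ∈ boundary X C)
    refine ⟨hvC, ?_⟩
    by_cases huh : u ∈ hatVertices X 𝒩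
    · exact ⟨⟨u, huh⟩, hu, fun he => hvC (he ▸ hu), Or.inl huv⟩
    · have hex : ∃ Q, IsSlice X 𝒩 Q ∧ u ∈ Q := by
        by_contra! hcon
        exact huh hcon
      obtain ⟨Q, hQs, huQ⟩ := hex
      obtain ⟨hQn, T, hT, hQT⟩ := id hQs
      have hQi := isComponent_iff.1 hQT
      have hQT' : boundary X Q ⊆ boundary X T := by
        simpa using Set.subset_compl_iff_disjoint_left.2 hQi.2.2
      have hQd := hN.disjoint_slice T hT C h Q hQT hQn
      have hQC : Q ⊆ C := connected_subset hQi.2.1 hQd ⟨u, huQ, hu⟩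
      have hvQ : (v : V) ∈ boundary X Q := ⟨fun hh => hvC (hQC hh), u, huQ, huv⟩
      -- Otherwise the connected set `C` could not leave `Q`, and the slice `Q` would equal `C`.
      obtain ⟨z, hz, hzC⟩ : ∃ z ∈ boundary X Q, z ∉ boundary X C := by
        by_contra! hcon
        have hCQ : C ⊆ Q := connected_subset (hN.connected C h)
          ((disjoint_boundary X C).mono_right hcon) ⟨u, hu, huQ⟩
        exact hQn (hQC.antisymm hCQ ▸ h)
      have hzC' : z ∈ C := (boundary_subset_of_subset hQC hz).resolve_right hzC
      exact ⟨⟨z, hN.mem_hatVertices_of_mem_boundary hT (hQT' hz)⟩, hzC',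
        fun he => hvC (he ▸ hzC'), Or.inr ⟨Q, hQs, hz, hvQ⟩⟩

theorem mem_star_hatCut (hN : IsNestedFamily X 𝒩) {C : Set V} (h : C ∈ 𝒩)
    {v : hatVertices X 𝒩} :
    v ∈ star (hatGraph X 𝒩) (hatCut X 𝒩 C) ↔ (v : V) ∈ star X C := by
  rw [mem_star, mem_star, hN.boundary_hatCut h]
  rfl

/-- Slices never swallow a whole cut: a vertex of `NC` keeps a neighbour in `Ĉ`. -/
theorem exists_mem_hatCut (hN : IsNestedFamily X 𝒩) {C : Set V} (h : C ∈ 𝒩) :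
    ∃ v : hatVertices X 𝒩, (v : V) ∈ C := by
  obtain ⟨s, hs⟩ := hN.nonempty_boundary C h
  have hs' : (⟨s, hN.mem_hatVertices_of_mem_boundary h hs⟩ : hatVertices X 𝒩) ∈
      boundary (hatGraph X 𝒩) (hatCut X 𝒩 C) := by
    rw [hN.boundary_hatCut h]; exact hs
  obtain ⟨-, w, hw, -⟩ := hs'
  exact ⟨w, hw⟩

theorem hatCut_injOn (hN : IsNestedFamily X 𝒩) : Set.InjOn (hatCut X 𝒩) 𝒩 := by
  intro C h D h' he
  have hb : ∀ v : hatVertices X 𝒩, (v : V) ∈ boundary X C ↔ (v : V) ∈ boundary X D := by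
    intro v
    have := congrArg (fun A => v ∈ boundary (hatGraph X 𝒩) A) he
    simpa [hN.boundary_hatCut h, hN.boundary_hatCut h'] using this
  obtain ⟨v, hv⟩ := hN.exists_mem_hatCut h
  have hvD : v ∈ hatCut X 𝒩 D := he ▸ hv
  refine hN.eq_of_boundary_eq h h' ?_ ⟨v, hv, hvD⟩
  ext x
  exact ⟨fun hx => (hb ⟨x, hN.mem_hatVertices_of_mem_boundary h hx⟩).1 hx,
    fun hx => (hb ⟨x, hN.mem_hatVertices_of_mem_boundary h' hx⟩).2 hx⟩

/-- With the slices gone, `Ĉ*` is covered by the members other than `C` at `NC`. Each lies in `D`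
when `C` and `D` face each other, and a vertex of `NC` in `D` makes the inclusion strict. -/
theorem star_hatCut_ssubset_iff (hN : IsNestedFamily X 𝒩) {C D : Set V} (h : C ∈ 𝒩)
    (h' : D ∈ 𝒩) : star (hatGraph X 𝒩) (hatCut X 𝒩 C) ⊂ hatCut X 𝒩 D ↔
      Faces X C (boundary X D) ∧ Faces X D (boundary X C) := by
  constructor
  · rintro ⟨hsub, hns⟩
    have hsub' : ∀ v ∈ hatVertices X 𝒩, v ∈ star X C → v ∈ D := fun v hv hvC =>
      hsub ((hN.mem_star_hatCut h (v := ⟨v, hv⟩)).2 hvC)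
    obtain ⟨C', hC', -, hCs'⟩ := hN.exists_other C h
    obtain ⟨p, hp⟩ := hN.exists_mem_hatCut hC'
    have hpD : (p : V) ∈ D := hsub' p p.2 (hCs' hp)
    have hpC : (p : V) ∉ C := (mem_star.1 (hCs' hp)).1
    have hne : boundary X D ≠ boundary X C := by
      intro hb
      have hCD : C ≠ D := fun he => hpC (he ▸ hpD)
      exact hns fun v hv => (hN.mem_star_hatCut h).2 (hN.subset_star_of_ne h h' hb.symm hCD hv)
    obtain ⟨C₁, hC₁, hb₁, hf₁⟩ := hN.exists_faces C h D h' hne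
    obtain ⟨D₁, hD₁, hb₂, hf₂⟩ := hN.exists_faces D h' C h hne.symm
    -- Otherwise `C₁ ⊆ C*`, so a vertex of `ND` in `C₁` would belong to `D`.
    have hCC : C = C₁ := by
      by_contra hcon
      obtain ⟨y, hy, -, hyC⟩ := hN.exists_mem_of_faces hC₁ h' hf₁
      exact hy.1 (hsub' y (hN.mem_hatVertices_of_mem_boundary h' hy)
        (hN.subset_star_of_ne h hC₁ hb₁.symm hcon hyC))
    subst hCC
    refine ⟨hf₁, ?_⟩
    by_cases hDD : D = D₁
    · rwa [hDD]
    · exact absurd (hN.subset_of_faces h' hD₁ h hb₂.symm hDD hf₂ hf₁ hpD) hpC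
  · rintro ⟨hf, hf'⟩
    obtain ⟨x, hx, hxD, hxD'⟩ := hN.exists_mem_of_faces h' h hf'
    refine ⟨fun v hv => ?_, fun hs => ?_⟩
    · have hv' := mem_star.1 ((hN.mem_star_hatCut h).1 hv)
      obtain ⟨Q, hQ, hQb, hvQ⟩ := hN.exists_mem_of_mem_hatVertices h v.2 hv'.2
      have hQC : Q ≠ C := fun he => hv'.1 (he ▸ hvQ)
      exact hN.subset_of_faces hQ h h' hQb hQC hf (hQb ▸ hf') hvQ
    · have hxm : (⟨x, hN.mem_hatVertices_of_mem_boundary h hx⟩ : hatVertices X 𝒩) ∈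
          hatCut X 𝒩 D := hxD'
      exact (mem_star.1 ((hN.mem_star_hatCut h).1 (hs hxm))).2 hx

/-- The relation `∼` in terms of the original graph. -/
theorem cutEquiv_iff (hN : IsNestedFamily X 𝒩) {C D : Set V} (h : C ∈ 𝒩) (h' : D ∈ 𝒩) :
    CutEquiv X 𝒩 C D ↔ C = D ∨ (Faces X C (boundary X D) ∧ Faces X D (boundary X C) ∧
      ¬ Separated X 𝒩 (boundary X C) (boundary X D)) := by
  rw [CutEquiv, Equiv₀, hN.hatCut_injOn.eq_iff h h', hN.star_hatCut_ssubset_iff h h', and_assoc]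
  refine or_congr_right (and_congr_right fun hf => and_congr_right fun hf' => ?_)
  constructor
  -- A separator in between supplies an intermediate cut: its member `E` facing `NC`.
  · rintro hall ⟨E, hE, E', hE', hb, hne, hfE, hfE'⟩
    have hCE : Faces X C (boundary X E) := hN.faces_of_between h h' hE hE' hb hne hfE hfE' hf
    have hDE : Faces X D (boundary X E) := by
      rw [hb]
      exact hN.faces_of_between h' h hE' hE hb.symm hne.symm hfE' hfE hf'
    have hED : E ⊆ D := hN.subset_of_faces hE hE' h' hb hne hfE' hDE
    have := hN.hatCut_injOn hE h' (hall _ ⟨E, hE, rfl⟩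
      ((hN.star_hatCut_ssubset_iff h hE).2 ⟨hCE, hfE⟩) fun v hv => hED hv)
    subst this
    exact hfE'.1 hb
  · rintro hns _ ⟨E, hE, rfl⟩ hCE hED
    by_contra hcon
    have hne : E ≠ D := fun he => hcon (he ▸ rfl)
    have hfE := ((hN.star_hatCut_ssubset_iff h hE).1 hCE).2
    have hb : boundary X D ≠ boundary X E := by
      intro hb
      obtain ⟨p, hp⟩ := hN.exists_mem_hatCut hE
      exact hne (hN.eq_of_boundary_eq hE h' hb.symm ⟨p, hp, hED hp⟩)
    obtain ⟨E', hE', hb', hf₁⟩ := hN.exists_faces E hE D h' hb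
    refine hns ⟨E, hE, E', hE', hb'.symm, ?_, hfE, hf₁⟩
    rintro rfl
    obtain ⟨x, hx, -, hxE⟩ := hN.exists_mem_of_faces hE h' hf₁
    have hxm : (⟨x, hN.mem_hatVertices_of_mem_boundary h' hx⟩ : hatVertices X 𝒩) ∈
        hatCut X 𝒩 E := hxE
    exact hx.1 (hED hxm)

/-- Only finitely many separators lie between two given ones. -/
theorem finite_between (hN : IsNestedFamily X 𝒩) {C D : Set V} (h : C ∈ 𝒩) (h' : D ∈ 𝒩) :
    {R | ∃ E ∈ 𝒩, ∃ E' ∈ 𝒩, boundary X E = R ∧ boundary X E' = R ∧ E ≠ E' ∧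
      Faces X E (boundary X C) ∧ Faces X E' (boundary X D)}.Finite := by
  have hfin : (⋃ x ∈ boundary X C, ⋃ y ∈ boundary X D,
      tightSeparators X x y (boundary X C).ncard).Finite :=
    (hN.finite_boundary C h).biUnion fun x _ => (hN.finite_boundary D h').biUnion fun y _ =>
      finite_tightSeparators _ X x y
  refine hfin.subset ?_
  rintro R ⟨E, hE, E', hE', rfl, hb, hne, hf, hf'⟩
  obtain ⟨x, hx, -, hxE⟩ := hN.exists_mem_of_faces hE h hf
  obtain ⟨y, hy, -, hyE⟩ := hN.exists_mem_of_faces hE' h' hf'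
  simp only [Set.mem_iUnion]
  refine ⟨x, hx, y, hy, hN.finite_boundary E hE, ?_, E, E', hN.connected E hE,
    hN.connected E' hE', hxE, hyE, hN.disjoint_of_ne hE hE' hb.symm hne, rfl, hb⟩
  rw [Set.ncard_def, Set.ncard_def, hN.encard_eq E hE C h]

end IsNestedFamily

end CutSystems

/-! ### Trees from direction systems. -/

namespace CutSystems

/-- Points `W` with a set `N` of directions at them, such that from each point every other point is
seen in one of its directions, and only finitely many points lie between two given ones. -/
structure DirectionSystem (N W : Type*) where
  /-- the point of a direction -/
  o : N → W
  /-- the direction at the first point in which the second one is seen -/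
  dir : W → W → N
  o_dir : ∀ S T, S ≠ T → o (dir S T) = S
  -- The tree-like axiom: a point that separates `S` from `T` hides `T` from `S`. All axioms
  -- constrain `dir` only off the diagonal.
  dir_eq : ∀ R S T, R ≠ S → R ≠ T → S ≠ T → dir R S ≠ dir R T → dir S R = dir S T
  finite_between : ∀ S T, {R | R ≠ S ∧ R ≠ T ∧ dir R S ≠ dir R T}.Finite

namespace DirectionSystem

variable {N W : Type*} (d : DirectionSystem N W)

/-- Two directions are related if they are equal or point to each other with no point between. -/
def Rel (C D : N) : Prop :=
  C = D ∨ (d.o C ≠ d.o D ∧ d.dir (d.o C) (d.o D) = C ∧ d.dir (d.o D) (d.o C) = D ∧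
    ∀ R, R ≠ d.o C → R ≠ d.o D → d.dir R (d.o C) = d.dir R (d.o D))

/-- For transitivity, a point away from all three sees them in one direction because nothing
separates the consecutive pairs, and the middle point sees both others in its own direction `D`. -/
theorem rel_equivalence : Equivalence d.Rel where
  refl C := Or.inl rfl
  symm {C D} h := by
    rcases h with rfl | ⟨h1, h2, h3, h4⟩
    · exact Or.inl rfl
    · exact Or.inr ⟨h1.symm, h3, h2, fun R h5 h6 => (h4 R h6 h5).symm⟩
  trans {C D E} h h' := by
    rcases h with rfl | ⟨h1, h2, h3, h4⟩
    · exact h'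
    rcases h' with rfl | ⟨h1', h2', h3', h4'⟩
    · exact Or.inr ⟨h1, h2, h3, h4⟩
    by_cases hCE : d.o C = d.o E
    · left
      rw [← h2, ← h3', hCE]
    · refine Or.inr ⟨hCE, ?_, ?_, fun R hR hR' => ?_⟩
      · rw [← h4' _ h1 hCE, h2]
      · rw [h4 _ (Ne.symm hCE) h1'.symm, h3']
      · by_cases hRD : R = d.o D
        · rw [hRD, h3, h2']
        · rw [h4 R hR hRD, h4' R hRD hR']

/-- Two uses of `dir_eq`: `R` sees `U` as it sees `S`, hence separates `U` from `T`, so `U` sees `T`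
as it sees `R`. -/
theorem between_trans {R S T U : W} (hR : R ≠ S ∧ R ≠ T ∧ d.dir R S ≠ d.dir R T)
    (hU : U ≠ S ∧ U ≠ R ∧ d.dir U S ≠ d.dir U R) :
    U ≠ S ∧ U ≠ T ∧ d.dir U S ≠ d.dir U T := by
  obtain ⟨hRS, hRT, hR⟩ := hR
  obtain ⟨hUS, hUR, hU⟩ := hU
  have h1 := d.dir_eq U R S hUR hUS hRS hU.symm
  have hUT : U ≠ T := by
    rintro rfl
    exact hR h1.symm
  have h2 := d.dir_eq R U T hUR.symm hRT hUT (h1 ▸ hR)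
  exact ⟨hUS, hUT, h2 ▸ hU⟩

variable {B : Type*} {t : N → B} {T : SimpleGraph (W ⊕ B)}

/-- With nothing in between, the two directions facing each other share a terminus. Otherwise a path
is split at an intermediate `R`, and by `between_trans` each half has strictly fewer points in
between. -/
theorem reachable_inl (hrel : ∀ C D, t C = t D ↔ d.Rel C D)
    (hadj : ∀ C, T.Adj (Sum.inl (d.o C)) (Sum.inr (t C))) (n : ℕ) : ∀ S S' : W,
    {R | R ≠ S ∧ R ≠ S' ∧ d.dir R S ≠ d.dir R S'}.ncard ≤ n →
      T.Reachable (Sum.inl S) (Sum.inl S') := by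
  induction n with
  | zero =>
    intro S S' h
    rw [Nat.le_zero, Set.ncard_eq_zero (d.finite_between S S')] at h
    by_cases hS : S = S'
    · rw [hS]
    have h1 := d.o_dir S S' hS
    have h2 := d.o_dir S' S (Ne.symm hS)
    have ht : t (d.dir S S') = t (d.dir S' S) := by
      rw [hrel]
      refine Or.inr ?_
      rw [h1, h2]
      refine ⟨hS, rfl, rfl, fun R hR hR' => ?_⟩
      by_contra hcon
      exact Set.eq_empty_iff_forall_notMem.1 h R ⟨hR, hR', hcon⟩
    have h3 := hadj (d.dir S S')
    have h4 := hadj (d.dir S' S)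
    rw [h1] at h3
    rw [h2, ← ht] at h4
    exact h3.reachable.trans h4.symm.reachable
  | succ n ih =>
    intro S S' h
    by_cases hne : {R | R ≠ S ∧ R ≠ S' ∧ d.dir R S ≠ d.dir R S'}.Nonempty
    · obtain ⟨R, hR⟩ := hne
      have hR' : R ≠ S' ∧ R ≠ S ∧ d.dir R S' ≠ d.dir R S := ⟨hR.2.1, hR.1, hR.2.2.symm⟩
      have h1 : {U | U ≠ S ∧ U ≠ R ∧ d.dir U S ≠ d.dir U R} ⊂
          {R | R ≠ S ∧ R ≠ S' ∧ d.dir R S ≠ d.dir R S'} :=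
        ⟨fun U hU => d.between_trans hR hU, fun hs => (hs hR).2.1 rfl⟩
      have h2 : {U | U ≠ S' ∧ U ≠ R ∧ d.dir U S' ≠ d.dir U R} ⊂
          {R | R ≠ S ∧ R ≠ S' ∧ d.dir R S ≠ d.dir R S'} := by
        refine ⟨fun U hU => ?_, fun hs => (hs hR).2.1 rfl⟩
        obtain ⟨h3, h4, h5⟩ := d.between_trans hR' hU
        exact ⟨h4, h3, h5.symm⟩
      have l1 := Set.ncard_lt_ncard h1 (d.finite_between S S')
      have l2 := Set.ncard_lt_ncard h2 (d.finite_between S S')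
      exact (ih S R (by omega)).trans (ih S' R (by omega)).symm
    · refine ih S S' ?_
      rw [Set.not_nonempty_iff_eq_empty.1 hne]
      simp

/-- Colour the points seen from `d.o C` in direction `C`, and the classes containing `C` or a
direction at such a point. Every edge but `C` has ends of equal colour, while the ends of `C`
differ. -/
theorem not_reachable_deleteEdges (hrel : ∀ C D, t C = t D ↔ d.Rel C D)
    (hadj : ∀ a b, T.Adj a b ↔ ∃ C, (a = Sum.inl (d.o C) ∧ b = Sum.inr (t C)) ∨
      (b = Sum.inl (d.o C) ∧ a = Sum.inr (t C))) (C : N) :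
    ¬ (T.deleteEdges {s(Sum.inl (d.o C), Sum.inr (t C))}).Reachable
      (Sum.inl (d.o C)) (Sum.inr (t C)) := by
  set g : N → Prop := fun D => D = C ∨ (d.o D ≠ d.o C ∧ d.dir (d.o C) (d.o D) = C) with hg
  -- The colour of a class does not depend on its representative.
  have hginv : ∀ D D', t D = t D' → g D → g D' := by
    intro D D' h hD
    rcases (hrel D D').1 h with rfl | ⟨h1, h2, h3, h4⟩
    · exact hD
    rcases hD with rfl | ⟨h5, h6⟩
    · exact Or.inr ⟨h1.symm, h2⟩
    · by_cases h7 : d.o D' = d.o C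
      · left
        rw [← h3, h7, h6]
      · exact Or.inr ⟨h7, (h4 _ (Ne.symm h5) (Ne.symm h7)) ▸ h6⟩
  set f : W ⊕ B → Prop := Sum.elim (fun S => S ≠ d.o C ∧ d.dir (d.o C) S = C)
    (fun b => ∃ D, t D = b ∧ g D) with hf
  have hedge : ∀ D, D ≠ C → (f (Sum.inl (d.o D)) ↔ f (Sum.inr (t D))) := by
    intro D hDC
    constructor
    · rintro ⟨h1, h2⟩
      exact ⟨D, rfl, Or.inr ⟨h1, h2⟩⟩
    · rintro ⟨D', h1, h2⟩
      exact (hginv D' D h1 h2).resolve_left hDC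
  have hstep : ∀ a b, (T.deleteEdges {s(Sum.inl (d.o C), Sum.inr (t C))}).Adj a b →
      (f a ↔ f b) := by
    intro a b hab
    rw [SimpleGraph.deleteEdges_adj, hadj] at hab
    obtain ⟨⟨D, ⟨rfl, rfl⟩ | ⟨rfl, rfl⟩⟩, hne⟩ := hab
    · exact hedge D fun he => hne (by rw [he]; rfl)
    · exact (hedge D fun he => hne (by rw [he, Sym2.eq_swap]; rfl)).symm
  rintro ⟨p⟩
  have key : ∀ a b, (T.deleteEdges {s(Sum.inl (d.o C), Sum.inr (t C))}).Walk a b →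
      (f a ↔ f b) := by
    intro a b p
    induction p with
    | nil => exact Iff.rfl
    | cons h _ ih => exact (hstep _ _ h).trans ih
  exact ((key _ _ p).2 ⟨C, rfl, Or.inl rfl⟩).1 rfl

/-- The bipartite graph of the points and the classes of directions is a tree. -/
theorem isTree [Nonempty W] (ht : Function.Surjective t) (hrel : ∀ C D, t C = t D ↔ d.Rel C D)
    (hadj : ∀ a b, T.Adj a b ↔ ∃ C, (a = Sum.inl (d.o C) ∧ b = Sum.inr (t C)) ∨
      (b = Sum.inl (d.o C) ∧ a = Sum.inr (t C))) : T.IsTree := by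
  have hadj' : ∀ C, T.Adj (Sum.inl (d.o C)) (Sum.inr (t C)) :=
    fun C => (hadj _ _).2 ⟨C, Or.inl ⟨rfl, rfl⟩⟩
  have hinl : ∀ a, ∃ S, T.Reachable a (Sum.inl S) := by
    rintro (S | b)
    · exact ⟨S, SimpleGraph.Reachable.refl _⟩
    · obtain ⟨C, rfl⟩ := ht b
      exact ⟨d.o C, (hadj' C).symm.reachable⟩
  refine { preconnected := fun a b => ?_, nonempty := ⟨Sum.inl (Classical.arbitrary W)⟩,
           isAcyclic := ?_ }
  · obtain ⟨S, hS⟩ := hinl a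
    obtain ⟨S', hS'⟩ := hinl b
    exact (hS.trans (d.reachable_inl hrel hadj' _ S S' le_rfl)).trans hS'.symm
  · rw [SimpleGraph.isAcyclic_iff_forall_adj_isBridge]
    intro a b hab
    obtain ⟨C, ⟨rfl, rfl⟩ | ⟨rfl, rfl⟩⟩ := (hadj a b).1 hab
    · exact SimpleGraph.isBridge_iff.2 (d.not_reachable_deleteEdges hrel hadj C)
    · rw [Sym2.eq_swap]
      exact SimpleGraph.isBridge_iff.2 (d.not_reachable_deleteEdges hrel hadj C)

end DirectionSystem

end CutSystems

/-! ### The structure tree of a nested family. -/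

namespace CutSystems

variable {V : Type u} {X : SimpleGraph V} {𝒞 𝒩 : Set (Set V)}

namespace IsNestedFamily

open Classical in
/-- The cut with separator `S` that faces `T`. -/
noncomputable def facingCut (X : SimpleGraph V) (𝒩 : Set (Set V)) (S T : boundary X '' 𝒩) : 𝒩 :=
  if h : ∃ E : 𝒩, boundary X E = S ∧ Faces X E T then h.choose
  -- For a nested family this default is reached only when `S = T`.
  else ⟨S.2.choose, S.2.choose_spec.1⟩

theorem facingCut_spec (hN : IsNestedFamily X 𝒩) {S T : boundary X '' 𝒩} (hST : S ≠ T) :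
    boundary X (facingCut X 𝒩 S T : Set V) = S ∧ Faces X (facingCut X 𝒩 S T) T := by
  obtain ⟨_, C, hC, rfl⟩ := S
  obtain ⟨_, D, hD, rfl⟩ := T
  have h : ∃ E : 𝒩, boundary X E = boundary X C ∧ Faces X E (boundary X D) := by
    obtain ⟨E, hE, h⟩ := hN.exists_faces C hC D hD fun he => hST (Subtype.ext he.symm)
    exact ⟨⟨E, hE⟩, h⟩
  rw [facingCut, dif_pos h]
  exact h.choose_spec

theorem facingCut_eq_iff (hN : IsNestedFamily X 𝒩) {S T : boundary X '' 𝒩} (hST : S ≠ T)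
    {E : 𝒩} (hE : boundary X (E : Set V) = S) : facingCut X 𝒩 S T = E ↔ Faces X E T := by
  have hs := hN.facingCut_spec hST
  constructor
  · intro h
    rw [← h]
    exact hs.2
  · obtain ⟨_, D, hD, rfl⟩ := T
    intro h
    exact Subtype.ext (hN.faces_unique (facingCut X 𝒩 S ⟨_, D, hD, rfl⟩).2 E.2 hD
      (hs.1.trans hE.symm) hs.2 h)

theorem facingCut_ne_iff (hN : IsNestedFamily X 𝒩) {R S T : boundary X '' 𝒩} (hS : R ≠ S)
    (hT : R ≠ T) : facingCut X 𝒩 R S ≠ facingCut X 𝒩 R T ↔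
      ∃ E ∈ 𝒩, ∃ E' ∈ 𝒩, boundary X E = R ∧ boundary X E' = R ∧ E ≠ E' ∧
        Faces X E S ∧ Faces X E' T := by
  constructor
  · intro h
    have h1 := hN.facingCut_spec hS
    have h2 := hN.facingCut_spec hT
    exact ⟨_, Subtype.mem _, _, Subtype.mem _, h1.1, h2.1, fun he => h (Subtype.ext he),
      h1.2, h2.2⟩
  · rintro ⟨E, hE, E', hE', hb, hb', hne, hf, hf'⟩ he
    have h1 := (hN.facingCut_eq_iff hS (E := ⟨E, hE⟩) hb).2 hf
    have h2 := (hN.facingCut_eq_iff hT (E := ⟨E', hE'⟩) hb').2 hf'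
    exact hne (congrArg Subtype.val (h1.symm.trans (he.trans h2)))

/-- The separators with the cuts as directions. -/
noncomputable def directions (hN : IsNestedFamily X 𝒩) :
    DirectionSystem 𝒩 (boundary X '' 𝒩) where
  o C := ⟨boundary X C, C, C.2, rfl⟩
  dir := facingCut X 𝒩
  o_dir S T h := Subtype.ext (hN.facingCut_spec h).1
  dir_eq R S T hRS hRT hST h := by
    obtain ⟨E, hE, E', hE', hb, hb', hne, hf, hf'⟩ := (hN.facingCut_ne_iff hRS hRT).1 h
    have hs := hN.facingCut_spec hST
    rw [hN.facingCut_eq_iff hRS.symm hs.1, ← hb]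
    obtain ⟨_, D, hD, rfl⟩ := T
    exact hN.faces_of_between (facingCut X 𝒩 S _).2 hD hE hE' (hb.trans hb'.symm) hne
      (by rwa [hs.1]) hf' hs.2
  finite_between := by
    rintro ⟨_, C, hC, rfl⟩ ⟨_, D, hD, rfl⟩
    refine Set.Finite.of_finite_image ((hN.finite_between hC hD).subset ?_)
      Subtype.val_injective.injOn
    rintro _ ⟨R, ⟨h1, h2, h3⟩, rfl⟩
    exact (hN.facingCut_ne_iff h1 h2).1 h3

theorem rel_iff (hN : IsNestedFamily X 𝒩) (C D : 𝒩) :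
    hN.directions.Rel C D ↔ CutEquiv X 𝒩 C D := by
  rw [hN.cutEquiv_iff C.2 D.2, DirectionSystem.Rel, Subtype.ext_iff]
  refine or_congr_right ?_
  by_cases hb : boundary X (C : Set V) = boundary X D
  · constructor
    · exact fun h => absurd (Subtype.ext hb) h.1
    · exact fun h => absurd hb.symm h.1.1
  have hne : hN.directions.o C ≠ hN.directions.o D := fun h => hb (congrArg Subtype.val h)
  refine (and_iff_right hne).trans (and_congr (hN.facingCut_eq_iff hne rfl)
    (and_congr (hN.facingCut_eq_iff hne.symm rfl) ?_))
  constructor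
  · rintro h ⟨E, hE, E', hE', hbE, hEE', hf, hf'⟩
    have h1 : hN.directions.o ⟨E, hE⟩ ≠ hN.directions.o C :=
      fun h => hf.1 (congrArg Subtype.val h).symm
    have h2 : hN.directions.o ⟨E, hE⟩ ≠ hN.directions.o D :=
      fun h => hf'.1 ((congrArg Subtype.val h).symm.trans hbE)
    exact (hN.facingCut_ne_iff h1 h2).2 ⟨E, hE, E', hE', rfl, hbE.symm, hEE', hf, hf'⟩ (h _ h1 h2)
  · intro h R h1 h2
    by_contra hcon
    obtain ⟨E, hE, E', hE', hb, hb', hne, hf, hf'⟩ := (hN.facingCut_ne_iff h1 h2).1 hcon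
    exact h ⟨E, hE, E', hE', hb.trans hb'.symm, hne, hf, hf'⟩

theorem cutEquiv_equivalence (hN : IsNestedFamily X 𝒩) :
    Equivalence (fun C D : 𝒩 => CutEquiv X 𝒩 (C : Set V) (D : Set V)) := by
  have h : (fun C D : 𝒩 => CutEquiv X 𝒩 (C : Set V) (D : Set V)) = hN.directions.Rel := by
    ext C D
    exact (hN.rel_iff C D).symm
  rw [h]
  exact hN.directions.rel_equivalence

theorem cutClass_eq_iff (hN : IsNestedFamily X 𝒩) (C D : 𝒩) :
    cutClass X 𝒩 C = cutClass X 𝒩 D ↔ CutEquiv X 𝒩 C D := by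
  have he := hN.cutEquiv_equivalence
  constructor
  · intro h
    have : (D : Set V) ∈ cutClass X 𝒩 C := h ▸ ⟨D.2, he.refl D⟩
    exact this.2
  · intro h
    ext E
    refine and_congr_right fun hE => ?_
    exact ⟨fun h' => he.trans (he.symm h) (z := ⟨E, hE⟩) h', fun h' => he.trans h (z := ⟨E, hE⟩) h'⟩

theorem isTree_structureTree (hN : IsNestedFamily X 𝒩) (hne : 𝒩.Nonempty) :
    (structureTree X 𝒩).IsTree := by
  have : Nonempty (boundary X '' 𝒩) := (hne.image _).to_subtype
  refine hN.directions.isTree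
    (t := fun C => (⟨cutClass X 𝒩 C, C, C.2, rfl⟩ : cutClass X 𝒩 '' 𝒩)) ?_ ?_ fun a b => Iff.rfl
  · rintro ⟨_, C, hC, rfl⟩
    exact ⟨⟨C, hC⟩, rfl⟩
  · intro C D
    rw [hN.rel_iff, ← hN.cutClass_eq_iff]
    exact Subtype.ext_iff

/-- Distinct equivalent cuts face each other, hence have distinct separators; so separator and class
determine the cut. -/
theorem edge_injective (hN : IsNestedFamily X 𝒩) :
    Function.Injective (fun C : 𝒩 => s(origin X 𝒩 C, terminus X 𝒩 C)) := by
  intro C D h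
  rcases Sym2.eq_iff.1 h with ⟨h1, h2⟩ | ⟨h1, -⟩
  · have hb : boundary X (C : Set V) = boundary X D :=
      congrArg Subtype.val (Sum.inl.inj h1)
    have hc : cutClass X 𝒩 C = cutClass X 𝒩 D := congrArg Subtype.val (Sum.inr.inj h2)
    rw [hN.cutClass_eq_iff, hN.cutEquiv_iff C.2 D.2] at hc
    exact hc.elim Subtype.ext fun hc => absurd hb.symm hc.1.1
  · exact absurd h1 (by simp [origin, terminus])

end IsNestedFamily

theorem range_edge (X : SimpleGraph V) (𝒩 : Set (Set V)) :
    Set.range (fun C : 𝒩 => s(origin X 𝒩 C, terminus X 𝒩 C)) =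
      (structureTree X 𝒩).edgeSet := by
  ext e
  induction e using Sym2.ind with
  | _ a b =>
    rw [SimpleGraph.mem_edgeSet]
    constructor
    · rintro ⟨C, hC⟩
      rcases Sym2.eq_iff.1 hC with ⟨h1, h2⟩ | ⟨h1, h2⟩
      · exact ⟨C, Or.inl ⟨h1.symm, h2.symm⟩⟩
      · exact ⟨C, Or.inr ⟨h1.symm, h2.symm⟩⟩
    · rintro ⟨C, ⟨rfl, rfl⟩ | ⟨rfl, rfl⟩⟩
      · exact ⟨C, rfl⟩
      · exact ⟨C, Sym2.eq_swap⟩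

/-! ### The group action -/

variable {G : Type v} [Group G] [MulAction G V]

theorem boundary_smul (hG : ∀ (g : G) (x y : V), X.Adj (g • x) (g • y) ↔ X.Adj x y) (g : G)
    (C : Set V) : boundary X (g • C) = g • boundary X C := by
  ext v
  rw [Set.mem_smul_set_iff_inv_smul_mem, mem_boundary, mem_boundary,
    Set.mem_smul_set_iff_inv_smul_mem]
  refine and_congr_right fun _ => ⟨?_, ?_⟩
  · rintro ⟨u, hu, huv⟩
    exact ⟨g⁻¹ • u, Set.mem_smul_set_iff_inv_smul_mem.1 hu, (hG _ _ _).2 huv⟩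
  · rintro ⟨u, hu, huv⟩
    refine ⟨g • u, Set.smul_mem_smul_set hu, ?_⟩
    rw [← hG g, smul_inv_smul] at huv
    exact huv

theorem star_smul_set (hG : ∀ (g : G) (x y : V), X.Adj (g • x) (g • y) ↔ X.Adj x y) (g : G)
    (C : Set V) : star X (g • C) = g • star X C := by
  rw [star, star, boundary_smul hG, ← Set.smul_set_union, Set.smul_set_compl]

theorem encard_boundary_smul (hG : ∀ (g : G) (x y : V), X.Adj (g • x) (g • y) ↔ X.Adj x y)
    (g : G) (C : Set V) : (boundary X (g • C)).encard = (boundary X C).encard := by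
  rw [boundary_smul hG]
  exact (MulAction.injective g).encard_image _

theorem nested_smul (hG : ∀ (g : G) (x y : V), X.Adj (g • x) (g • y) ↔ X.Adj x y)
    (hinv : ∀ (g : G), ∀ C ∈ 𝒞, g • C ∈ 𝒞) (g : G) {C D : Set V} (h : Nested X 𝒞 C D) :
    Nested X 𝒞 (g • C) (g • D) := by
  obtain ⟨E, F, hE, hF, h1, h2, h3⟩ := h
  refine ⟨g • E, g • F, ?_, ?_, ?_, ?_, ?_⟩
  · rw [star_smul_set hG]
    exact hE.imp (congrArg _) (congrArg _)
  · rw [star_smul_set hG]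
    exact hF.imp (congrArg _) (congrArg _)
  · rintro ⟨L, hL, hs⟩
    refine h1 ⟨g⁻¹ • L, hinv _ _ hL, ?_⟩
    rw [← Set.smul_set_inter] at hs
    simpa using Set.smul_set_mono (a := g⁻¹) hs
  · rw [boundary_smul hG, ← Set.smul_set_inter, h2, Set.smul_set_empty]
  · rw [boundary_smul hG, ← Set.smul_set_inter, h3, Set.smul_set_empty]

theorem nested_smul_iff (hG : ∀ (g : G) (x y : V), X.Adj (g • x) (g • y) ↔ X.Adj x y)
    (hinv : ∀ (g : G), ∀ C ∈ 𝒞, g • C ∈ 𝒞) (g : G) {C D : Set V} :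
    Nested X 𝒞 (g • C) (g • D) ↔ Nested X 𝒞 C D :=
  ⟨fun h => by simpa using nested_smul hG hinv g⁻¹ h, nested_smul hG hinv g⟩

theorem smul_mem_thinCuts (hG : ∀ (g : G) (x y : V), X.Adj (g • x) (g • y) ↔ X.Adj x y)
    (hinv : ∀ (g : G), ∀ C ∈ 𝒞, g • C ∈ 𝒞) (g : G) {C : Set V} (h : C ∈ thinCuts X 𝒞) :
    g • C ∈ thinCuts X 𝒞 :=
  ⟨hinv g C h.1, fun D hD => by rw [encard_boundary_smul hG]; exact h.2 D hD⟩

theorem mu_smul (hG : ∀ (g : G) (x y : V), X.Adj (g • x) (g • y) ↔ X.Adj x y)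
    (hinv : ∀ (g : G), ∀ C ∈ 𝒞, g • C ∈ 𝒞) (g : G) (C : Set V) :
    mu X 𝒞 (g • C) = mu X 𝒞 C := by
  have h : {D | D ∈ thinCuts X 𝒞 ∧ ¬ Nested X 𝒞 (g • C) D} =
      (fun D => g • D) '' {D | D ∈ thinCuts X 𝒞 ∧ ¬ Nested X 𝒞 C D} := by
    ext D
    constructor
    · rintro ⟨hD, hn⟩
      refine ⟨g⁻¹ • D, ⟨smul_mem_thinCuts hG hinv _ hD, fun hh => hn ?_⟩, smul_inv_smul g D⟩
      simpa using nested_smul hG hinv g hh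
    · rintro ⟨D, ⟨hD, hn⟩, rfl⟩
      exact ⟨smul_mem_thinCuts hG hinv _ hD, fun hh => hn ((nested_smul_iff hG hinv g).1 hh)⟩
  rw [mu, mu, h]
  exact (MulAction.injective g).encard_image _

theorem smul_mem_optimallyNested
    (hG : ∀ (g : G) (x y : V), X.Adj (g • x) (g • y) ↔ X.Adj x y)
    (hinv : ∀ (g : G), ∀ C ∈ 𝒞, g • C ∈ 𝒞) (g : G) {C : Set V} (h : C ∈ optimallyNested X 𝒞) :
    g • C ∈ optimallyNested X 𝒞 :=
  ⟨smul_mem_thinCuts hG hinv g h.1, fun D hD => by rw [mu_smul hG hinv]; exact h.2 D hD⟩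

theorem faces_smul (hG : ∀ (g : G) (x y : V), X.Adj (g • x) (g • y) ↔ X.Adj x y) (g : G)
    {C T : Set V} : Faces X (g • C) (g • T) ↔ Faces X C T := by
  rw [Faces, Faces, boundary_smul hG, ← Set.smul_set_union, Set.smul_set_subset_smul_set_iff]
  exact and_congr_left fun _ => (MulAction.injective g).ne_iff

theorem separated_smul (hG : ∀ (g : G) (x y : V), X.Adj (g • x) (g • y) ↔ X.Adj x y)
    (hinv : ∀ (g : G), ∀ C ∈ 𝒩, g • C ∈ 𝒩) (g : G) {S T : Set V}
    (h : Separated X 𝒩 S T) : Separated X 𝒩 (g • S) (g • T) := by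
  obtain ⟨E, hE, E', hE', hb, hne, hf, hf'⟩ := h
  exact ⟨g • E, hinv g E hE, g • E', hinv g E' hE', by rw [boundary_smul hG, boundary_smul hG, hb],
    fun h => hne (MulAction.injective g h), (faces_smul hG g).2 hf, (faces_smul hG g).2 hf'⟩

namespace IsNestedFamily

/-- The description of `∼` inside `X` makes this immediate, with no need for an action on `X̂`. -/
theorem cutEquiv_smul (hN : IsNestedFamily X 𝒩)
    (hG : ∀ (g : G) (x y : V), X.Adj (g • x) (g • y) ↔ X.Adj x y)
    (hinv : ∀ (g : G), ∀ C ∈ 𝒩, g • C ∈ 𝒩) (g : G) {C D : Set V} (h : C ∈ 𝒩) (h' : D ∈ 𝒩)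
    (hCD : CutEquiv X 𝒩 C D) : CutEquiv X 𝒩 (g • C) (g • D) := by
  rw [hN.cutEquiv_iff (hinv g C h) (hinv g D h')]
  rcases (hN.cutEquiv_iff h h').1 hCD with rfl | ⟨h1, h2, h3⟩
  · exact Or.inl rfl
  · rw [boundary_smul hG, boundary_smul hG, faces_smul hG, faces_smul hG]
    refine Or.inr ⟨h1, h2, fun hs => h3 ?_⟩
    simpa using separated_smul hG hinv g⁻¹ hs

theorem cutClass_smul (hN : IsNestedFamily X 𝒩)
    (hG : ∀ (g : G) (x y : V), X.Adj (g • x) (g • y) ↔ X.Adj x y)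
    (hinv : ∀ (g : G), ∀ C ∈ 𝒩, g • C ∈ 𝒩) (g : G) {C : Set V} (h : C ∈ 𝒩) :
    cutClass X 𝒩 (g • C) = g • cutClass X 𝒩 C := by
  ext D
  rw [Set.mem_smul_set_iff_inv_smul_mem]
  constructor
  · rintro ⟨hD, hCD⟩
    refine ⟨hinv _ _ hD, ?_⟩
    simpa using hN.cutEquiv_smul hG hinv g⁻¹ (hinv g C h) hD hCD
  · rintro ⟨hD, hCD⟩
    have hgD := hinv g _ hD
    have := hN.cutEquiv_smul hG hinv g h hD hCD
    rw [smul_inv_smul] at hgD this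
    exact ⟨hgD, this⟩

theorem exists_action (hN : IsNestedFamily X 𝒩)
    (hG : ∀ (g : G) (x y : V), X.Adj (g • x) (g • y) ↔ X.Adj x y)
    (hinv : ∀ (g : G), ∀ C ∈ 𝒩, g • C ∈ 𝒩) :
    ∃ φ : G →* (structureTree X 𝒩 ≃g structureTree X 𝒩),
      ∀ (g : G) (C : 𝒩), ∃ h : g • (C : Set V) ∈ 𝒩,
        φ g (origin X 𝒩 C) = origin X 𝒩 ⟨g • (C : Set V), h⟩ ∧
        φ g (terminus X 𝒩 C) = terminus X 𝒩 ⟨g • (C : Set V), h⟩ := by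
  have hW : ∀ (g : G), ∀ S ∈ boundary X '' 𝒩, g • S ∈ boundary X '' 𝒩 := by
    rintro g _ ⟨C, hC, rfl⟩
    exact ⟨g • C, hinv g C hC, boundary_smul hG g C⟩
  have hB : ∀ (g : G), ∀ S ∈ cutClass X 𝒩 '' 𝒩, g • S ∈ cutClass X 𝒩 '' 𝒩 := by
    rintro g _ ⟨C, hC, rfl⟩
    exact ⟨g • C, hinv g C hC, hN.cutClass_smul hG hinv g hC⟩
  let τ : G → TreeVertex X 𝒩 → TreeVertex X 𝒩 := fun g =>
    Sum.map (fun S => ⟨g • (S : Set V), hW g S S.2⟩) (fun S => ⟨g • (S : Set (Set V)), hB g S S.2⟩)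
  have hone : ∀ a, τ 1 a = a := by
    rintro (⟨S, hS⟩ | ⟨S, hS⟩)
    · exact congrArg Sum.inl (Subtype.ext (one_smul G S))
    · exact congrArg Sum.inr (Subtype.ext (one_smul G S))
  have hmul : ∀ g h a, τ (g * h) a = τ g (τ h a) := by
    rintro g h (⟨S, hS⟩ | ⟨S, hS⟩)
    · exact congrArg Sum.inl (Subtype.ext (mul_smul g h S))
    · exact congrArg Sum.inr (Subtype.ext (mul_smul g h S))
  have ho : ∀ (g : G) (C : 𝒩),
      τ g (origin X 𝒩 C) = origin X 𝒩 ⟨g • (C : Set V), hinv g C C.2⟩ := fun g C =>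
    congrArg Sum.inl (Subtype.ext (boundary_smul hG g (C : Set V)).symm)
  have ht : ∀ (g : G) (C : 𝒩),
      τ g (terminus X 𝒩 C) = terminus X 𝒩 ⟨g • (C : Set V), hinv g C C.2⟩ := fun g C =>
    congrArg Sum.inr (Subtype.ext (hN.cutClass_smul hG hinv g C.2).symm)
  have hadj : ∀ g a b, (structureTree X 𝒩).Adj a b → (structureTree X 𝒩).Adj (τ g a) (τ g b) := by
    rintro g _ _ ⟨C, ⟨rfl, rfl⟩ | ⟨rfl, rfl⟩⟩
    · exact ⟨_, Or.inl ⟨ho g C, ht g C⟩⟩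
    · exact ⟨_, Or.inr ⟨ho g C, ht g C⟩⟩
  have hinv' : ∀ g a, τ g⁻¹ (τ g a) = a := fun g a => by rw [← hmul, inv_mul_cancel, hone]
  have hinv'' : ∀ g a, τ g (τ g⁻¹ a) = a := fun g a => by rw [← hmul, mul_inv_cancel, hone]
  let ψ : G → (structureTree X 𝒩 ≃g structureTree X 𝒩) := fun g =>
    { toFun := τ g
      invFun := τ g⁻¹
      left_inv := hinv' g
      right_inv := hinv'' g
      map_rel_iff' := fun {a b} =>
        ⟨fun h => hinv' g a ▸ hinv' g b ▸ hadj g⁻¹ _ _ h, fun h => hadj g a b h⟩ }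
  refine ⟨⟨⟨ψ, RelIso.ext hone⟩, fun g h => RelIso.ext (hmul g h)⟩, fun g C =>
    ⟨hinv g C C.2, ho g C, ht g C⟩⟩

end IsNestedFamily

end CutSystems

theorem theorem8p1 {V : Type u} {G : Type v} [Group G] [MulAction G V]
    (X : SimpleGraph V) (hX : X.Connected)
    (hG : ∀ (g : G) (x y : V), X.Adj (g • x) (g • y) ↔ X.Adj x y)
    (𝒞 : Set (Set V)) (hC : CutSystems.IsCutSystem X 𝒞) (hne : 𝒞.Nonempty)
    (hinv : ∀ (g : G), ∀ C ∈ 𝒞, g • C ∈ 𝒞)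
    (𝒩 : Set (Set V)) (hN : 𝒩 = CutSystems.optimallyNested X 𝒞) :
    -- the optimally nested thin cuts form a cut system, and are pairwise nested
    CutSystems.IsCutSystem X 𝒩 ∧
    (∀ C ∈ 𝒩, ∀ D ∈ 𝒩, CutSystems.Nested X 𝒞 C D) ∧
    -- the black vertices of the structure graph are the classes of an equivalence relation
    Equivalence (fun C D : 𝒩 => CutSystems.CutEquiv X 𝒩 (C : Set V) (D : Set V)) ∧
    -- the structure graph is a tree
    (CutSystems.structureTree X 𝒩).IsTree ∧
    -- its edges correspond bijectively to the elements of `𝒩`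
    Function.Injective
      (fun C : 𝒩 => s(CutSystems.origin X 𝒩 C, CutSystems.terminus X 𝒩 C)) ∧
    Set.range (fun C : 𝒩 => s(CutSystems.origin X 𝒩 C, CutSystems.terminus X 𝒩 C)) =
      (CutSystems.structureTree X 𝒩).edgeSet ∧
    -- `G` acts on it by automorphisms, and the induced action on edges is that on `𝒩`
    ∃ φ : G →* (CutSystems.structureTree X 𝒩 ≃g CutSystems.structureTree X 𝒩),
      ∀ (g : G) (C : 𝒩), ∃ h : g • (C : Set V) ∈ 𝒩,
        φ g (CutSystems.origin X 𝒩 C) = CutSystems.origin X 𝒩 ⟨g • (C : Set V), h⟩ ∧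
        φ g (CutSystems.terminus X 𝒩 C) = CutSystems.terminus X 𝒩 ⟨g • (C : Set V), h⟩ := by
  subst hN
  have hN := hC.isNestedFamily_optimallyNested hX
  exact ⟨hC.isCutSystem_optimallyNested hX, fun C h D h' => hC.nested_of_optimallyNested h h',
    hN.cutEquiv_equivalence,
    hN.isTree_structureTree (CutSystems.IsCutSystem.exists_optimallyNested hne),
    hN.edge_injective, CutSystems.range_edge X _,
    hN.exists_action hG fun g C h => CutSystems.smul_mem_optimallyNested hG hinv g h⟩
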